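/- Let $n\ge 2$ and $s\in(1/2,1)$. For a set $S\subset\mathbb R^m$, $C_b^k(S)$ ($k\le\infty$) denotes the functions on $S$ with bounded continuous derivatives of all finite orders in $[0,k]$. The infinity fractional Laplacian of $\phi:\mathbb R^n\to\mathbb R$ is $$\Delta_\infty^s\phi(x)=C_s\sup_{|y|=1}\ \inf_{|\tilde y|=1}\int_0^\infty\big(\phi(x+\eta y)+\phi(x-\eta\tilde y)-2\phi(x)\big)\frac{d\eta}{\eta^{1+2s}},\qquad C_s=\frac{4^s s\,\Gamma(\frac12+s)}{\pi^{1/2}\,\Gamma(1-s)},$$ where the integrals take values in $[-\infty,\infty]$. Given $u_0:\mathbb R^n\to\mathbb R$, a classical solution of $$\partial_t u=\Delta_\infty^s u\ \text{ in } \mathbb R^n\times(0,\infty),\qquad u(\cdot,0)=u_0\ \text{ in } \mathbb R^n, \qquad (\ast)$$ is a function $u\in C_b^2(\mathbb R^n\times[0,\infty))$ that satisfies both equalities at every point. Let $$P_s(x,t)=\frac1{2\pi}\int_{\mathbb R}e^{ix\xi}e^{-t|\xi|^{2s}}\,d\xi\qquad(x\in\mathbb R,\ t>0)$$ be the fundamental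 solution of the one-dimensional fractional heat equation $\partial_t v+(-\partial_{xx}^2)^s v=0$. **Theorem 2.10 (Classical solutions with one-dimensional profiles).** Assume that $U_0\in C_b^\infty(\mathbb R)$ is nondecreasing, and let $u_0(x):=U_0(x_1)$ for $x=(x_1,\dots,x_n)\in\mathbb R^n$. Then there exists a classical solution $u\in C_b^\infty(\mathbb R^n\times[0,\infty))$ of $(\ast)$. Moreover, for all $x\in\mathbb R^n$ and $t>0$, $$u(x,t)=(P_s(\cdot,t)*U_0)(x_1)=\int_{-\infty}^\infty P_s(x_1-r,t)\,U_0(r)\,dr,$$ where the integral converges absolutely. -/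

import Mathlib

open MeasureTheory Set
open scoped ENNReal FourierTransform

noncomputable section

/-- `f ∈ C_b^k(S)`: `f` is of class `C^k` on `S`, and all its derivatives of order at most `k`
(including `f` itself) are bounded on `S`. For `k = ⊤` this is `C_b^∞(S)`. -/
def IsCb {E F : Type*} [NormedAddCommGroup E] [NormedSpace ℝ E]
    [NormedAddCommGroup F] [NormedSpace ℝ F] (k : ℕ∞) (f : E → F) (S : Set E) : Prop :=
  ContDiffOn ℝ (k : WithTop ℕ∞) f S ∧
    ∀ m : ℕ, (m : ℕ∞) ≤ k → ∃ C : ℝ, ∀ p ∈ S, ‖iteratedFDerivWithin ℝ m f S p‖ ≤ C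

/-- The Lebesgue integral of a real function over `(0, ∞)` with values in `[-∞, ∞]`: integral of
the positive part minus integral of the negative part. It is meaningful as soon as one of the two
is finite. -/
def extIntegral (f : ℝ → ℝ) : EReal :=
  ((∫⁻ η in Ioi (0 : ℝ), ENNReal.ofReal (f η) : ℝ≥0∞) : EReal) -
    ((∫⁻ η in Ioi (0 : ℝ), ENNReal.ofReal (-f η) : ℝ≥0∞) : EReal)

/-- The normalizing constant `C_s = 4^s s Γ(1/2 + s) / (π^{1/2} Γ(1 - s))`. -/
def fracConst (s : ℝ) : ℝ :=
  (4 : ℝ) ^ s * s * Real.Gamma (1 / 2 + s) / (Real.pi ^ (1 / 2 : ℝ) * Real.Gamma (1 - s))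

/-- The infinity fractional Laplacian
`C_s sup_{|y|=1} inf_{|y'|=1} ∫_0^∞ (φ(x + η y) + φ(x - η y') - 2 φ(x)) dη / η^{1+2s}`.
For `s ∈ (1/2, 1)` and a bounded `φ` that is `C^{1,1}` at `x`, the single integrals may be `+∞`
or `-∞` (when `∇φ(x) · (y - y') ≠ 0`), hence the extended real values. -/
def infFracLaplacian {n : ℕ} (s : ℝ) (φ : EuclideanSpace ℝ (Fin n) → ℝ)
    (x : EuclideanSpace ℝ (Fin n)) : EReal :=
  (fracConst s : EReal) *
    ⨆ y ∈ Metric.sphere (0 : EuclideanSpace ℝ (Fin n)) 1,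
      ⨅ y' ∈ Metric.sphere (0 : EuclideanSpace ℝ (Fin n)) 1,
        extIntegral fun η : ℝ =>
          (φ (x + η • y) + φ (x - η • y') - 2 * φ x) / η ^ (1 + 2 * s)

/-- `u` is a classical solution on `ℝⁿ × [0, ∞)` of `∂_t u = Δ_∞^s u` for `t > 0`, with
`u(·, 0) = u₀`: it is of class `C_b^2` and satisfies the equation and the initial condition
at every point. The values of `u` at negative times are irrelevant. -/
structure IsClassicalSolution {n : ℕ} (s : ℝ) (u₀ : EuclideanSpace ℝ (Fin n) → ℝ)
    (u : EuclideanSpace ℝ (Fin n) → ℝ → ℝ) : Prop where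
  regular : IsCb 2 (fun p : EuclideanSpace ℝ (Fin n) × ℝ => u p.1 p.2)
    ((univ : Set (EuclideanSpace ℝ (Fin n))) ×ˢ Ici (0 : ℝ))
  equation : ∀ (x : EuclideanSpace ℝ (Fin n)) (t : ℝ), 0 < t →
    ((deriv (fun τ : ℝ => u x τ) t : ℝ) : EReal) = infFracLaplacian s (fun z => u z t) x
  initial : ∀ x : EuclideanSpace ℝ (Fin n), u x 0 = u₀ x

/-- The fundamental solution of `∂_t v + (-∂_{xx}^2)^s v = 0` on `ℝ`: the inverse Fourier transform
of `exp(-t |ξ|^{2s})` in the convention `P_s(x, t) = (2π)⁻¹ ∫ exp(i x ξ) exp(-t |ξ|^{2s}) dξ`, in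
which `(-∂_{xx}^2)^s` has the symbol `|ξ|^{2s}`. Mathlib's `𝓕⁻ g x = ∫ exp(2 π i ω x) g(ω) dω`
gives this after the substitution `ξ = 2 π ω`; the value is real. -/
def fracHeatKernel (s x t : ℝ) : ℝ :=
  (𝓕⁻ (fun ω : ℝ => ((Real.exp (-(t * |2 * Real.pi * ω| ^ (2 * s))) : ℝ) : ℂ)) x).re

end

/-! For a nondecreasing profile `φ` of the single variable `x_i`, every unit vector satisfies `y_i ≤
1`. Hence `y = e_i` maximizes `φ(x + η y)` and `y' = e_i` minimizes `φ(x - η y')`, for every `η > 0`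
at once. The sup-inf is thus attained at `e_i` and the operator collapses to the linear
one-dimensional `fracLap` (`infFracLaplacian_profile`). It remains to solve the fractional heat
equation on the line within monotone `C_b^∞` profiles.

The solution is convolution with the stable density, in the self-similar form `∫ p(y) f(x -
t^(1/(2s)) y) dy`, which is also meaningful at `t = 0`. Monotonicity in `x` requires `p ≥ 0`. This
is a stable limit theorem: `exp(-|w|^(2s))` is a limit of powers of the characteristic function of a
symmetric Pareto law, and nonnegativity of the transform survives products and limits
(`cosTransformNonneg_exp_neg_rpow`). Positivity and Gaussian regularization give `p ∈ L¹`; Fourier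
inversion then gives its characteristic function and mass one.

Write `S` for the semigroup and `L` for `fracLap`. The constant `C_s` is exactly the one for which
`L` has symbol `-|ξ|^(2s)`. On Fourier superpositions this yields `S_t f = f + ∫_0^t S_τ L f dτ`,
and truncation extends it to all of `C_b^∞`. Since `L` preserves `C_b^∞` and commutes with `S_t`,
the function `S f` solves the equation. Its partial derivatives are `S f'` and `S L f`, of the same
form, so induction gives bounded derivatives of all orders up to `t = 0`. -/

noncomputable section

open Filter Topology
open scoped ContDiff

/-! ### Bounded smooth functions, second differences and the fractional Laplacian. -/

/-- `C_b^∞(ℝ)`: smooth functions on the line all of whose derivatives are bounded. -/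
def IsBddSmooth (f : ℝ → ℝ) : Prop :=
  ContDiff ℝ ∞ f ∧ ∀ m : ℕ, ∃ C : ℝ, ∀ x, |iteratedDeriv m f x| ≤ C

/-- The symmetric second difference of `f` at `x` with step `η`. -/
def secondDiff (f : ℝ → ℝ) (x η : ℝ) : ℝ := f (x + η) + f (x - η) - 2 * f x

/-- The one-dimensional fractional Laplacian `-(-∂²)^s` as a singular integral. -/
def fracLap (s : ℝ) (f : ℝ → ℝ) (x : ℝ) : ℝ :=
  fracConst s * ∫ η in Ioi (0 : ℝ), secondDiff f x η / η ^ (1 + 2 * s)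

/-- The integrable majorant of the Lévy density against second differences. -/
def levyWeight (s η : ℝ) : ℝ := min 1 (η ^ 2) / η ^ (1 + 2 * s)

/-- Second differences of `f` are bounded by `M * min 1 η²`. -/
def SecondDiffBound (M : ℝ) (f : ℝ → ℝ) : Prop :=
  ∀ x η, |secondDiff f x η| ≤ M * min 1 (η ^ 2)

lemma isBddSmooth_of_isCb {f : ℝ → ℝ} (hf : IsCb ⊤ f univ) : IsBddSmooth f := by
  refine ⟨contDiffOn_univ.1 hf.1, fun m => ?_⟩
  obtain ⟨C, hC⟩ := hf.2 m le_top
  refine ⟨C, fun x => ?_⟩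
  have := hC x (mem_univ x)
  rwa [iteratedFDerivWithin_univ, norm_iteratedFDeriv_eq_norm_iteratedDeriv] at this

namespace IsBddSmooth

variable {f : ℝ → ℝ}

lemma iteratedDeriv (hf : IsBddSmooth f) (m : ℕ) : IsBddSmooth (iteratedDeriv m f) := by
  refine ⟨?_, fun k => ?_⟩
  · rw [iteratedDeriv_eq_iterate]
    exact hf.1.iterate_deriv m
  · obtain ⟨C, hC⟩ := hf.2 (k + m)
    refine ⟨C, fun x => ?_⟩
    rw [iteratedDeriv_eq_iterate, iteratedDeriv_eq_iterate, ← Function.iterate_add_apply,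
      ← iteratedDeriv_eq_iterate]
    exact hC x

lemma deriv (hf : IsBddSmooth f) : IsBddSmooth (deriv f) := by
  simpa [iteratedDeriv_one] using hf.iteratedDeriv 1

lemma differentiable (hf : IsBddSmooth f) : Differentiable ℝ f :=
  hf.1.differentiable (by simp)

lemma hasDerivAt (hf : IsBddSmooth f) (x : ℝ) : HasDerivAt f (_root_.deriv f x) x :=
  (hf.differentiable x).hasDerivAt

lemma continuous (hf : IsBddSmooth f) : Continuous f := hf.1.continuous

lemma exists_bound (hf : IsBddSmooth f) : ∃ C, 0 ≤ C ∧ ∀ x, |f x| ≤ C := by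
  obtain ⟨C, hC⟩ := hf.2 0
  exact ⟨C, (abs_nonneg _).trans (hC 0), by simpa using hC⟩

lemma exists_lipschitz (hf : IsBddSmooth f) : ∃ C, 0 ≤ C ∧ ∀ x y, |f x - f y| ≤ C * |x - y| := by
  obtain ⟨C, hC0, hC⟩ := hf.deriv.exists_bound
  refine ⟨C, hC0, fun x y => ?_⟩
  exact Convex.norm_image_sub_le_of_norm_deriv_le (s := univ) (fun z _ => hf.differentiable z)
    (fun z _ => hC z) convex_univ (mem_univ y) (mem_univ x)

lemma hasDerivAt_secondDiff (hf : IsBddSmooth f) (x η : ℝ) :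
    HasDerivAt (fun x => secondDiff f x η) (secondDiff (_root_.deriv f) x η) x := by
  unfold secondDiff
  have h1 := (hf.hasDerivAt (x + η)).comp_add_const x η
  have h2 := (hf.hasDerivAt (x - η)).comp_sub_const x η
  exact (h1.add h2).sub ((hf.hasDerivAt x).const_mul 2)

/-- In the step variable `z` the second difference has derivative `f'(x + z) - f'(x - z)`, at most
`2C|z|` when `f'` is `C`-Lipschitz; the mean value inequality supplies the other factor `|η|`. -/
lemma exists_secondDiff_le_sq (hf : IsBddSmooth f) :
    ∃ C, 0 ≤ C ∧ ∀ x η, |secondDiff f x η| ≤ C * η ^ 2 := by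
  obtain ⟨C, hC0, hC⟩ := hf.deriv.exists_lipschitz
  refine ⟨2 * C, by positivity, fun x η => ?_⟩
  have hd : ∀ z, HasDerivAt (fun z => secondDiff f x z)
      (_root_.deriv f (x + z) - _root_.deriv f (x - z)) z := by
    intro z
    unfold secondDiff
    have h1 := (hf.hasDerivAt (x + z)).comp_const_add x z
    have h2 := (hf.hasDerivAt (x - z)).comp_const_sub x z
    exact ((h1.add h2).sub_const _).congr_deriv (by ring)
  have key := Convex.norm_image_sub_le_of_norm_hasDerivWithin_le (s := uIcc 0 η)
    (f := fun z => secondDiff f x z) (C := 2 * C * |η|) (x := 0) (y := η)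
    (fun z _ => (hd z).hasDerivWithinAt) (fun z hz => ?_) (convex_uIcc 0 η)
    left_mem_uIcc right_mem_uIcc
  · have h0 : secondDiff f x 0 = 0 := by unfold secondDiff; simp; ring
    rw [h0, sub_zero, sub_zero, Real.norm_eq_abs, Real.norm_eq_abs] at key
    calc _ ≤ _ := key
      _ = 2 * C * (|η| * |η|) := by ring
      _ = _ := by rw [abs_mul_abs_self]; ring
  · have hz' : |z| ≤ |η| := by simpa using abs_sub_left_of_mem_uIcc hz
    calc _ ≤ C * |x + z - (x - z)| := hC _ _
      _ = C * (2 * |z|) := by rw [show x + z - (x - z) = 2 * z by ring, abs_mul]; simp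
      _ ≤ C * (2 * |η|) := by gcongr
      _ = _ := by ring

end IsBddSmooth

lemma secondDiffBound_of_le {f : ℝ → ℝ} {A B : ℝ} (hA : 0 ≤ A) (hB : 0 ≤ B)
    (h0 : ∀ x, |f x| ≤ A) (h2 : ∀ x η, |secondDiff f x η| ≤ B * η ^ 2) :
    SecondDiffBound (4 * A + B) f := by
  intro x η
  rcases min_choice 1 (η ^ 2) with h | h <;> rw [h]
  · have a1 := abs_le.1 (h0 (x + η))
    have a2 := abs_le.1 (h0 (x - η))
    have a3 := abs_le.1 (h0 x)
    rw [secondDiff, abs_le]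
    constructor <;> linarith
  · exact (h2 x η).trans (by gcongr; linarith)

lemma IsBddSmooth.exists_secondDiffBound {f : ℝ → ℝ} (hf : IsBddSmooth f) :
    ∃ M, 0 ≤ M ∧ SecondDiffBound M f := by
  obtain ⟨A, hA, h0⟩ := hf.exists_bound
  obtain ⟨B, hB, h2⟩ := hf.exists_secondDiff_le_sq
  exact ⟨4 * A + B, by positivity, secondDiffBound_of_le hA hB h0 h2⟩

/-- The weight is `η^(1-2s)` near zero, integrable as `s < 1`, and `η^(-1-2s)` at infinity,
integrable as `s > 0`. -/
lemma integrableOn_levyWeight {s : ℝ} (hs : 0 < s) (hs' : s < 1) :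
    IntegrableOn (levyWeight s) (Ioi 0) := by
  rw [← Ioc_union_Ioi_eq_Ioi (zero_le_one (α := ℝ))]
  refine IntegrableOn.union ?_ ?_
  · have h : IntegrableOn (fun η : ℝ => η ^ (1 - 2 * s)) (Ioc 0 1) :=
      (intervalIntegral.intervalIntegrable_rpow' (by linarith)).1
    refine h.congr_fun (fun η hη => ?_) measurableSet_Ioc
    have h1 : η ^ 2 ≤ 1 := pow_le_one₀ hη.1.le hη.2
    simp only [levyWeight, min_eq_right h1]
    rw [show 1 - 2 * s = (2 : ℕ) - (1 + 2 * s) by push_cast; ring, Real.rpow_sub hη.1,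
      Real.rpow_natCast]
  · have h : IntegrableOn (fun η : ℝ => η ^ (-(1 + 2 * s))) (Ioi 1) :=
      integrableOn_Ioi_rpow_of_lt (by linarith) one_pos
    refine h.congr_fun (fun η hη => ?_) measurableSet_Ioi
    have h1 : 1 ≤ η ^ 2 := one_le_pow₀ (le_of_lt hη)
    simp only [levyWeight, min_eq_left h1]
    rw [Real.rpow_neg (zero_le_one.trans (le_of_lt hη)), one_div]

lemma SecondDiffBound.norm_div_le {M : ℝ} {f : ℝ → ℝ} (h : SecondDiffBound M f) (s x : ℝ) {η : ℝ}
    (hη : 0 < η) : ‖secondDiff f x η / η ^ (1 + 2 * s)‖ ≤ M * levyWeight s η := by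
  rw [norm_div, Real.norm_eq_abs, Real.norm_of_nonneg (Real.rpow_nonneg hη.le _), levyWeight,
    ← mul_div_assoc]
  gcongr
  exact h x η

lemma continuousOn_secondDiff_div {f : ℝ → ℝ} (hf : Continuous f) (s x : ℝ) :
    ContinuousOn (fun η => secondDiff f x η / η ^ (1 + 2 * s)) (Ioi 0) := by
  unfold secondDiff
  refine ContinuousOn.div (by fun_prop) ?_ (fun η hη => (Real.rpow_pos_of_pos hη _).ne')
  exact continuousOn_id.rpow_const (fun η hη => Or.inl (ne_of_gt hη))

lemma SecondDiffBound.integrableOn {M : ℝ} {f : ℝ → ℝ} (h : SecondDiffBound M f)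
    (hf : Continuous f) {s : ℝ} (hs : 0 < s) (hs' : s < 1) (x : ℝ) :
    IntegrableOn (fun η => secondDiff f x η / η ^ (1 + 2 * s)) (Ioi 0) := by
  refine Integrable.mono' ((integrableOn_levyWeight hs hs').const_mul M)
    ((continuousOn_secondDiff_div hf s x).aestronglyMeasurable measurableSet_Ioi) ?_
  exact (ae_restrict_iff' measurableSet_Ioi).2 (ae_of_all _ fun η hη => h.norm_div_le s x hη)

lemma SecondDiffBound.abs_fracLap_le {M : ℝ} {f : ℝ → ℝ} (h : SecondDiffBound M f)
    {s : ℝ} (hs : 0 < s) (hs' : s < 1) (x : ℝ) :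
    |fracLap s f x| ≤ |fracConst s| * (M * ∫ η in Ioi (0 : ℝ), levyWeight s η) := by
  rw [fracLap, abs_mul, ← integral_const_mul]
  gcongr
  refine norm_integral_le_of_norm_le (f := fun η => secondDiff f x η / η ^ (1 + 2 * s))
    ((integrableOn_levyWeight hs hs').const_mul M) ?_
  exact (ae_restrict_iff' measurableSet_Ioi).2 (ae_of_all _ fun η hη => h.norm_div_le s x hη)

namespace IsBddSmooth

variable {f : ℝ → ℝ}

lemma hasDerivAt_fracLap (hf : IsBddSmooth f) {s : ℝ} (hs : 0 < s) (hs' : s < 1) (x : ℝ) :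
    HasDerivAt (fracLap s f) (fracLap s (_root_.deriv f) x) x := by
  obtain ⟨M, -, hM⟩ := hf.exists_secondDiffBound
  obtain ⟨M', -, hM'⟩ := hf.deriv.exists_secondDiffBound
  refine HasDerivAt.const_mul _ (hasDerivAt_integral_of_dominated_loc_of_deriv_le
    (bound := fun η => M' * levyWeight s η) (s := univ)
    (F' := fun x η => secondDiff (_root_.deriv f) x η / η ^ (1 + 2 * s))
    univ_mem ?_ ?_ ?_ ?_ ?_ ?_).2
  · exact Eventually.of_forall fun y =>
      (continuousOn_secondDiff_div hf.continuous s y).aestronglyMeasurable measurableSet_Ioi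
  · exact hM.integrableOn hf.continuous hs hs' x
  · exact (continuousOn_secondDiff_div hf.deriv.continuous s x).aestronglyMeasurable
      measurableSet_Ioi
  · exact (ae_restrict_iff' measurableSet_Ioi).2
      (ae_of_all _ fun η hη y _ => hM'.norm_div_le s y hη)
  · exact (integrableOn_levyWeight hs hs').const_mul M'
  · exact ae_of_all _ fun η y _ => (hf.hasDerivAt_secondDiff y η).div_const _

lemma iteratedDeriv_fracLap (hf : IsBddSmooth f) {s : ℝ} (hs : 0 < s) (hs' : s < 1) (m : ℕ) :
    _root_.iteratedDeriv m (fracLap s f) = fracLap s (_root_.iteratedDeriv m f) := by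
  induction m with
  | zero => simp
  | succ m ih =>
    rw [iteratedDeriv_succ, ih, iteratedDeriv_succ]
    exact funext fun x => ((hf.iteratedDeriv m).hasDerivAt_fracLap hs hs' x).deriv

/-- Differentiation passes under the singular integral, so each derivative of `L f` is `L` of a
derivative of `f`. This closure lets time derivatives be iterated later. -/
lemma fracLap (hf : IsBddSmooth f) {s : ℝ} (hs : 0 < s) (hs' : s < 1) :
    IsBddSmooth (fracLap s f) := by
  refine ⟨contDiff_of_differentiable_iteratedDeriv fun m _ x => ?_, fun m => ?_⟩
  · rw [hf.iteratedDeriv_fracLap hs hs']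
    exact ((hf.iteratedDeriv m).hasDerivAt_fracLap hs hs' x).differentiableAt
  · obtain ⟨M, -, hM⟩ := (hf.iteratedDeriv m).exists_secondDiffBound
    exact ⟨_, fun x => by
      rw [hf.iteratedDeriv_fracLap hs hs']
      exact hM.abs_fracLap_le hs hs' x⟩

end IsBddSmooth

/-! ### Gaussian integrals and the normalizing constant. -/

lemma integrable_gaussian_mul {b : ℝ} (hb : 0 < b) {g : ℝ → ℝ} (hg : Continuous g) {C : ℝ}
    (hC : ∀ x, |g x| ≤ C) : Integrable (fun x => g x * Real.exp (-b * x ^ 2)) :=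
  (integrable_exp_neg_mul_sq hb).bdd_mul hg.aestronglyMeasurable (ae_of_all _ hC)

lemma integral_cos_mul_gaussian {b : ℝ} (hb : 0 < b) (t : ℝ) :
    ∫ x : ℝ, Real.cos (t * x) * Real.exp (-b * x ^ 2) =
      √(Real.pi / b) * Real.exp (-t ^ 2 / (4 * b)) := by
  have h := fourierIntegral_gaussian (b := (b : ℂ)) (by simpa using hb) (t : ℂ)
  have h2 := congrArg Complex.re h
  have hint : Integrable fun x : ℝ =>
      Complex.exp (Complex.I * t * x) * Complex.exp (-(b : ℂ) * x ^ 2) := by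
    have := (integrable_exp_neg_mul_sq hb).ofReal (𝕜 := ℂ)
    refine (this.bdd_mul (c := 1) (f := fun x : ℝ => Complex.exp (Complex.I * t * x))
      (by fun_prop) (ae_of_all _ fun x => ?_)).congr (ae_of_all _ fun x => ?_)
    · rw [show Complex.I * t * x = ((t * x : ℝ) : ℂ) * Complex.I by push_cast; ring,
        Complex.norm_exp_ofReal_mul_I]
    · simp
  rw [← RCLike.re_eq_complex_re, ← integral_re hint] at h2
  simp only [RCLike.re_eq_complex_re] at h2
  have e1 : ∀ x : ℝ, (Complex.exp (Complex.I * t * x) * Complex.exp (-(b : ℂ) * x ^ 2)).re =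
      Real.cos (t * x) * Real.exp (-b * x ^ 2) := by
    intro x
    rw [show Complex.I * t * x = ((t * x : ℝ) : ℂ) * Complex.I by push_cast; ring,
      show -(b : ℂ) * x ^ 2 = ((-b * x ^ 2 : ℝ) : ℂ) by push_cast; ring, ← Complex.ofReal_exp,
      Complex.re_mul_ofReal, Complex.exp_ofReal_mul_I_re]
  simp only [e1] at h2
  rw [h2, Real.sqrt_eq_rpow]
  have e2 : ((Real.pi : ℂ) / b) ^ (1 / 2 : ℂ) = (((Real.pi / b) ^ (1 / 2 : ℝ) : ℝ) : ℂ) := by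
    rw [Complex.ofReal_cpow (by positivity)]; push_cast; rfl
  rw [e2, show -(t : ℂ) ^ 2 / (4 * b) = ((-t ^ 2 / (4 * b) : ℝ) : ℂ) by push_cast; ring,
    ← Complex.ofReal_exp, ← Complex.ofReal_mul, Complex.ofReal_re]

lemma integral_Ioi_one_sub_cos_mul_gaussian {b : ℝ} (hb : 0 < b) :
    ∫ x in Ioi (0 : ℝ), (1 - Real.cos x) * Real.exp (-b * x ^ 2) =
      √(Real.pi / b) / 2 * (1 - Real.exp (-(1 / (4 * b)))) := by
  have h := integral_comp_abs (f := fun x => (1 - Real.cos x) * Real.exp (-b * x ^ 2))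
  simp only [Real.cos_abs, sq_abs] at h
  have h2 : ∫ x : ℝ, (1 - Real.cos x) * Real.exp (-b * x ^ 2) =
      √(Real.pi / b) * (1 - Real.exp (-(1 / (4 * b)))) := by
    simp only [sub_mul, one_mul]
    rw [integral_sub (integrable_exp_neg_mul_sq hb)
      (integrable_gaussian_mul hb Real.continuous_cos Real.abs_cos_le_one), integral_gaussian]
    have := integral_cos_mul_gaussian hb 1
    simp only [one_mul] at this
    rw [this, show -(1 : ℝ) ^ 2 / (4 * b) = -(1 / (4 * b)) by ring]
    ring
  linarith

/-- Fubini applied to `1 - exp(-cx) = x ∫_0^c exp(-rx) dr`; the inner integral in `x` is then a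
Gamma integral. -/
lemma integral_rpow_mul_one_sub_exp {s c : ℝ} (hs : 0 < s) (hs' : s < 1) (hc : 0 < c) :
    ∫ x in Ioi (0 : ℝ), x ^ (-s - 1) * (1 - Real.exp (-(c * x))) =
      c ^ s / s * Real.Gamma (1 - s) := by
  have hG : ∀ r : ℝ, 0 < r → ∫ x in Ioi (0 : ℝ), x ^ (-s) * Real.exp (-(r * x)) =
      r ^ (s - 1) * Real.Gamma (1 - s) := by
    intro r hr
    have := Real.integral_rpow_mul_exp_neg_mul_Ioi (a := 1 - s) (by linarith) hr
    rw [show 1 - s - 1 = -s by ring] at this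
    rw [this, one_div, Real.inv_rpow hr.le, ← Real.rpow_neg hr.le, neg_sub]
  have hint : Integrable (Function.uncurry fun (x r : ℝ) => x ^ (-s) * Real.exp (-(r * x)))
      ((volume.restrict (Ioi 0)).prod (volume.restrict (Ioc 0 c))) := by
    have hmeas : AEStronglyMeasurable
        (Function.uncurry fun (x r : ℝ) => x ^ (-s) * Real.exp (-(r * x)))
        ((volume.restrict (Ioi (0 : ℝ))).prod (volume.restrict (Ioc 0 c))) := by
      apply Measurable.aestronglyMeasurable
      unfold Function.uncurry
      fun_prop
    rw [integrable_prod_iff' hmeas]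
    constructor
    · refine (ae_restrict_iff' measurableSet_Ioc).2 (ae_of_all _ fun r hr => ?_)
      have := integrableOn_rpow_mul_exp_neg_mul_rpow (p := 1) (s := -s) (b := r) (by linarith)
        one_pos hr.1
      simp only [Real.rpow_one, neg_mul] at this
      exact this
    · have h : IntegrableOn (fun r : ℝ => r ^ (s - 1) * Real.Gamma (1 - s)) (Ioc 0 c) :=
        ((intervalIntegral.intervalIntegrable_rpow' (by linarith)).1).mul_const _
      refine h.congr_fun (fun r hr => ?_) measurableSet_Ioc
      dsimp only
      rw [← hG r hr.1]
      refine setIntegral_congr_fun measurableSet_Ioi fun x hx => ?_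
      have hx : 0 < x := hx
      exact (Real.norm_of_nonneg (by positivity)).symm
  have hswap := integral_integral_swap hint
  have hR : ∫ r in Ioc 0 c, ∫ x in Ioi (0 : ℝ), x ^ (-s) * Real.exp (-(r * x)) =
      c ^ s / s * Real.Gamma (1 - s) := by
    rw [setIntegral_congr_fun measurableSet_Ioc (fun r hr => hG r hr.1), integral_mul_const,
      ← intervalIntegral.integral_of_le hc.le, integral_rpow (Or.inl (by linarith))]
    simp [Real.zero_rpow hs.ne']
  rw [← hR, ← hswap]
  refine setIntegral_congr_fun measurableSet_Ioi fun x hx => ?_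
  have hx : 0 < x := hx
  rw [integral_const_mul, ← intervalIntegral.integral_of_le hc.le]
  have : ∫ r in (0 : ℝ)..c, Real.exp (-(r * x)) = x⁻¹ * (1 - Real.exp (-(c * x))) := by
    have hd : ∀ r ∈ uIcc 0 c, HasDerivAt (fun r => -(x⁻¹ * Real.exp (-(r * x))))
        (Real.exp (-(r * x))) r := by
      intro r _
      have := ((((hasDerivAt_id r).mul_const x).neg.exp).const_mul x⁻¹).neg
      refine this.congr_deriv ?_
      simp only [id, Pi.neg_apply]
      field_simp
    rw [intervalIntegral.integral_eq_sub_of_hasDerivAt hd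
      (Continuous.intervalIntegrable (by fun_prop) _ _)]
    simp
    ring
  rw [this, ← mul_assoc, Real.rpow_sub hx, Real.rpow_one, div_eq_mul_inv]

lemma secondDiffBound_cos : SecondDiffBound 6 Real.cos := by
  intro x η
  have h : secondDiff Real.cos x η = -(2 * (1 - Real.cos η)) * Real.cos x := by
    rw [secondDiff, Real.cos_add, Real.cos_sub]; ring
  have h1 : |2 * (1 - Real.cos η)| ≤ 6 * min 1 (η ^ 2) := by
    rw [abs_of_nonneg (by linarith [Real.cos_le_one η])]
    rcases min_choice 1 (η ^ 2) with h | h <;> rw [h]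
    · linarith [Real.neg_one_le_cos η]
    · nlinarith [Real.one_sub_sq_div_two_le_cos (x := η), sq_nonneg η]
  rw [h, abs_mul, abs_neg]
  calc _ ≤ |2 * (1 - Real.cos η)| * 1 := by gcongr; exact Real.abs_cos_le_one x
    _ ≤ _ := by rwa [mul_one]

/-- `∫₀^∞ (1 - cos η) / η^(1+2s) dη`. -/
def cosLevyIntegral (s : ℝ) : ℝ := ∫ η in Ioi (0 : ℝ), (1 - Real.cos η) / η ^ (1 + 2 * s)

lemma integrableOn_one_sub_cos_div {s : ℝ} (hs : 0 < s) (hs' : s < 1) :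
    IntegrableOn (fun η => (1 - Real.cos η) / η ^ (1 + 2 * s)) (Ioi 0) := by
  have := (secondDiffBound_cos.integrableOn Real.continuous_cos hs hs' 0).const_mul (-1 / 2)
  refine this.congr (ae_of_all _ fun η => ?_)
  simp [secondDiff]; ring

/-- This makes the symbol of `fracLap` exactly `-|ξ|^(2s)`. Up to the factor `Γ(s + 1/2)`,
`u^(-1-2s)` is the integral of `l^(s-1/2) exp(-u² l)` over `l`; after Fubini the `u`-integral is
Gaussian, and what is left is a Gamma-type integral in `1/l`. -/
lemma two_mul_fracConst_mul_cosLevyIntegral {s : ℝ} (hs : 0 < s) (hs' : s < 1) :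
    2 * fracConst s * cosLevyIntegral s = 1 := by
  have hG : ∀ u : ℝ, 0 < u → ∫ l in Ioi (0 : ℝ), (1 - Real.cos u) *
      (l ^ (s - 1 / 2) * Real.exp (-(u ^ 2 * l))) =
      Real.Gamma (s + 1 / 2) * ((1 - Real.cos u) / u ^ (1 + 2 * s)) := by
    intro u hu
    have := Real.integral_rpow_mul_exp_neg_mul_Ioi (a := s + 1 / 2) (r := u ^ 2) (by linarith)
      (by positivity)
    rw [show s + 1 / 2 - 1 = s - 1 / 2 by ring] at this
    rw [integral_const_mul, this, one_div, Real.inv_rpow (by positivity), ← Real.rpow_natCast u 2,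
      ← Real.rpow_mul hu.le, show ((2 : ℕ) : ℝ) * (s + 1 / 2) = 1 + 2 * s by push_cast; ring]
    ring
  have hint : Integrable (Function.uncurry fun (u l : ℝ) => (1 - Real.cos u) *
      (l ^ (s - 1 / 2) * Real.exp (-(u ^ 2 * l))))
      ((volume.restrict (Ioi 0)).prod (volume.restrict (Ioi 0))) := by
    have hmeas : AEStronglyMeasurable (Function.uncurry fun (u l : ℝ) => (1 - Real.cos u) *
        (l ^ (s - 1 / 2) * Real.exp (-(u ^ 2 * l))))
        ((volume.restrict (Ioi (0 : ℝ))).prod (volume.restrict (Ioi 0))) := by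
      apply Measurable.aestronglyMeasurable
      unfold Function.uncurry
      fun_prop
    rw [integrable_prod_iff hmeas]
    constructor
    · refine (ae_restrict_iff' measurableSet_Ioi).2 (ae_of_all _ fun u hu => ?_)
      have hu : 0 < u := hu
      have := integrableOn_rpow_mul_exp_neg_mul_rpow (p := 1) (s := s - 1 / 2) (b := u ^ 2)
        (by linarith) one_pos (by positivity)
      simp only [Real.rpow_one, neg_mul] at this
      exact Integrable.const_mul (c := 1 - Real.cos u) this
    · refine IntegrableOn.congr_fun
        ((integrableOn_one_sub_cos_div hs hs').const_mul (Real.Gamma (s + 1 / 2)))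
        (fun u hu => ?_) measurableSet_Ioi
      have hu : 0 < u := hu
      rw [← hG u hu]
      refine setIntegral_congr_fun measurableSet_Ioi fun x hx => ?_
      have hx : 0 < x := hx
      have := Real.cos_le_one u
      refine (Real.norm_of_nonneg (mul_nonneg (by linarith) (by positivity))).symm
  have hswap := integral_integral_swap hint
  have hL : ∫ u in Ioi (0 : ℝ), ∫ l in Ioi (0 : ℝ), (1 - Real.cos u) *
      (l ^ (s - 1 / 2) * Real.exp (-(u ^ 2 * l))) =
      Real.Gamma (s + 1 / 2) * cosLevyIntegral s := by
    rw [setIntegral_congr_fun measurableSet_Ioi (fun u hu => hG u hu), integral_const_mul,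
      cosLevyIntegral]
  have hsub : ∫ l in Ioi (0 : ℝ), l ^ (s - 1) * (1 - Real.exp (-(1 / (4 * l)))) =
      (1 / 4) ^ s / s * Real.Gamma (1 - s) := by
    -- The substitution `l ↦ 1/l`, as a change of variables by the power `-1`.
    rw [← integral_rpow_mul_one_sub_exp hs hs' (by norm_num : (0 : ℝ) < 1 / 4),
      ← integral_comp_rpow_Ioi (fun x : ℝ => x ^ (-s - 1) * (1 - Real.exp (-(1 / 4 * x))))
        (p := -1) (by norm_num)]
    refine setIntegral_congr_fun measurableSet_Ioi fun x hx => ?_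
    have hx : 0 < x := hx
    simp only [smul_eq_mul, abs_neg, abs_one, one_mul]
    rw [← Real.rpow_mul hx.le, ← mul_assoc, ← Real.rpow_add hx, Real.rpow_neg_one]
    congr 2
    · ring
    · congr 2; field_simp
  have hR : ∫ l in Ioi (0 : ℝ), ∫ u in Ioi (0 : ℝ), (1 - Real.cos u) *
      (l ^ (s - 1 / 2) * Real.exp (-(u ^ 2 * l))) =
      √Real.pi / 2 * ((1 / 4) ^ s / s * Real.Gamma (1 - s)) := by
    rw [← hsub, ← integral_const_mul]
    refine setIntegral_congr_fun measurableSet_Ioi fun l hl => ?_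
    have hl : 0 < l := hl
    have h1 : ∀ u : ℝ, (1 - Real.cos u) * (l ^ (s - 1 / 2) * Real.exp (-(u ^ 2 * l))) =
        l ^ (s - 1 / 2) * ((1 - Real.cos u) * Real.exp (-l * u ^ 2)) := by
      intro u; rw [show -(u ^ 2 * l) = -l * u ^ 2 by ring]; ring
    simp only [h1]
    rw [integral_const_mul, integral_Ioi_one_sub_cos_mul_gaussian hl, Real.sqrt_div Real.pi_pos.le,
      Real.sqrt_eq_rpow l, show s - 1 = s - 1 / 2 - 1 / 2 by ring, Real.rpow_sub hl (s - 1 / 2)]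
    ring
  rw [hL, hR] at hswap
  have hΓ : 0 < Real.Gamma (s + 1 / 2) := Real.Gamma_pos_of_pos (by linarith)
  have hΓ' : 0 < Real.Gamma (1 - s) := Real.Gamma_pos_of_pos (by linarith)
  have hπ : 0 < √Real.pi := Real.sqrt_pos.2 Real.pi_pos
  have h4 : (0 : ℝ) < 4 ^ s := by positivity
  rw [one_div 4, Real.inv_rpow (by norm_num)] at hswap
  have hK : cosLevyIntegral s =
      √Real.pi / 2 * ((4 ^ s)⁻¹ / s * Real.Gamma (1 - s)) / Real.Gamma (s + 1 / 2) := by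
    rw [← hswap]; field_simp
  rw [hK, fracConst, ← Real.sqrt_eq_rpow, add_comm (1 / 2) s]
  field_simp

lemma fracConst_pos {s : ℝ} (hs : 0 < s) (hs' : s < 1) : 0 < fracConst s := by
  have h1 : 0 < Real.Gamma (1 / 2 + s) := Real.Gamma_pos_of_pos (by linarith)
  have h2 : 0 < Real.Gamma (1 - s) := Real.Gamma_pos_of_pos (by linarith)
  unfold fracConst
  positivity

lemma cosLevyIntegral_pos {s : ℝ} (hs : 0 < s) (hs' : s < 1) : 0 < cosLevyIntegral s := by
  have h := two_mul_fracConst_mul_cosLevyIntegral hs hs'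
  have h2 := fracConst_pos hs hs'
  by_contra! h3
  nlinarith

lemma integral_Ioi_one_sub_cos_mul_div (s : ℝ) {a ξ : ℝ} (ha : 0 ≤ a) (hξ : 0 < ξ) :
    ∫ η in Ioi a, (1 - Real.cos (ξ * η)) / η ^ (1 + 2 * s) =
      ξ ^ (2 * s) * ∫ η in Ioi (ξ * a), (1 - Real.cos η) / η ^ (1 + 2 * s) := by
  have h := integral_comp_mul_left_Ioi (fun u : ℝ => (1 - Real.cos u) / u ^ (1 + 2 * s)) a hξ
  have h2 : ∫ η in Ioi (ξ * a), (1 - Real.cos η) / η ^ (1 + 2 * s) =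
      ξ * ∫ η in Ioi a, (1 - Real.cos (ξ * η)) / (ξ * η) ^ (1 + 2 * s) := by
    rw [h, smul_eq_mul, mul_inv_cancel_left₀ hξ.ne']
  rw [h2, ← integral_const_mul, ← integral_const_mul]
  refine setIntegral_congr_fun measurableSet_Ioi fun η hη => ?_
  have hη : 0 < η := ha.trans_lt hη
  rw [Real.mul_rpow hξ.le hη.le, Real.rpow_add hξ, Real.rpow_one]
  have := (Real.rpow_pos_of_pos hξ (2 * s)).ne'
  have := (Real.rpow_pos_of_pos hη (1 + 2 * s)).ne'
  field_simp

lemma integral_one_sub_cos_mul_div {s : ℝ} (hs : 0 < s) (ξ : ℝ) :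
    ∫ η in Ioi (0 : ℝ), (1 - Real.cos (ξ * η)) / η ^ (1 + 2 * s) =
      |ξ| ^ (2 * s) * cosLevyIntegral s := by
  rcases eq_or_ne ξ 0 with rfl | h
  · simp [Real.zero_rpow (by positivity : 2 * s ≠ 0)]
  · have := integral_Ioi_one_sub_cos_mul_div s le_rfl (abs_pos.2 h)
    rw [mul_zero] at this
    rw [cosLevyIntegral, ← this]
    refine setIntegral_congr_fun measurableSet_Ioi fun η hη => ?_
    have hη : 0 < η := hη
    rw [← Real.cos_abs (ξ * η), abs_mul, abs_of_pos hη]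

/-! ### Positivity of the stable density through Pareto laws. -/

/-- The cosine transform of `H` is nonnegative. -/
def CosTransformNonneg (H : ℝ → ℝ) : Prop := ∀ x : ℝ, 0 ≤ ∫ w, Real.cos (w * x) * H w

/-- The characteristic function of the symmetric Pareto law with density
`s |η|^(-1-2s)` on `|η| > 1`. -/
def paretoCharFun (s w : ℝ) : ℝ :=
  2 * s * ∫ η in Ioi (1 : ℝ), Real.cos (w * η) * η ^ (-(1 + 2 * s))

lemma cosTransformNonneg_gaussian {b : ℝ} (hb : 0 < b) :
    CosTransformNonneg (fun w => Real.exp (-b * w ^ 2)) := by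
  intro x
  simp only [mul_comm _ x]
  rw [integral_cos_mul_gaussian hb]
  positivity

lemma integrableOn_pareto {s : ℝ} (hs : 0 < s) :
    IntegrableOn (fun η : ℝ => η ^ (-(1 + 2 * s))) (Ioi 1) :=
  integrableOn_Ioi_rpow_of_lt (by linarith) one_pos

lemma integral_pareto {s : ℝ} (hs : 0 < s) :
    2 * s * ∫ η in Ioi (1 : ℝ), η ^ (-(1 + 2 * s)) = 1 := by
  rw [integral_Ioi_rpow_of_lt (by linarith) one_pos, Real.one_rpow]
  have : -(1 + 2 * s) + 1 = -(2 * s) := by ring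
  rw [this]
  field_simp

lemma integrableOn_cos_mul_pareto {s : ℝ} (hs : 0 < s) (w : ℝ) :
    IntegrableOn (fun η : ℝ => Real.cos (w * η) * η ^ (-(1 + 2 * s))) (Ioi 1) :=
  Integrable.bdd_mul (c := 1) (integrableOn_pareto hs)
    (by fun_prop : Continuous fun η => Real.cos (w * η)).aestronglyMeasurable
    (ae_of_all _ fun η => Real.abs_cos_le_one _)

lemma abs_paretoCharFun_le_one {s : ℝ} (hs : 0 < s) (w : ℝ) : |paretoCharFun s w| ≤ 1 := by
  rw [← integral_pareto hs, paretoCharFun, abs_mul, abs_of_pos (by positivity : 0 < 2 * s)]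
  gcongr
  refine norm_integral_le_of_norm_le
    (f := fun η : ℝ => Real.cos (w * η) * η ^ (-(1 + 2 * s))) (integrableOn_pareto hs) ?_
  refine (ae_restrict_iff' measurableSet_Ioi).2 (ae_of_all _ fun η hη => ?_)
  have hη : 0 < η := zero_lt_one.trans hη
  rw [norm_mul, Real.norm_of_nonneg (by positivity : 0 ≤ η ^ (-(1 + 2 * s)))]
  exact mul_le_of_le_one_left (by positivity) (Real.abs_cos_le_one _)

lemma measurable_paretoCharFun (s : ℝ) : Measurable (paretoCharFun s) := by
  unfold paretoCharFun
  refine Measurable.const_mul (StronglyMeasurable.measurable ?_) _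
  refine StronglyMeasurable.integral_prod_right (f := fun (w η : ℝ) =>
    Real.cos (w * η) * η ^ (-(1 + 2 * s))) ?_
  apply Measurable.stronglyMeasurable
  fun_prop

/-- Rescaling the tail integral exposes the behaviour at small `w`: one minus `2s w^(2s)` times a
quantity tending to `cosLevyIntegral s`. -/
lemma paretoCharFun_eq {s : ℝ} (hs : 0 < s) {w : ℝ} (hw : 0 < w) :
    paretoCharFun s w =
      1 + -(2 * s * w ^ (2 * s) * ∫ η in Ioi w, (1 - Real.cos η) / η ^ (1 + 2 * s)) := by
  have h := integral_Ioi_one_sub_cos_mul_div s zero_le_one hw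
  rw [mul_one] at h
  rw [mul_assoc (2 * s), ← h]
  refine Eq.trans ?_ (congrArg (· + _) (integral_pareto hs))
  rw [paretoCharFun, ← mul_neg, ← mul_add, ← integral_neg, ← integral_add (integrableOn_pareto hs)]
  · congr 1
    refine setIntegral_congr_fun measurableSet_Ioi fun η hη => ?_
    have hη : 0 < η := zero_lt_one.trans hη
    rw [Real.rpow_neg hη.le]
    ring
  · refine Integrable.neg (((integrableOn_pareto hs).sub
      (integrableOn_cos_mul_pareto hs w)).congr_fun (fun η hη => ?_) measurableSet_Ioi)
    have hη : 0 < η := zero_lt_one.trans hη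
    simp only [Pi.sub_apply]
    rw [Real.rpow_neg hη.le]
    ring

/-- Multiplication by a characteristic function averages the transform over translates: the product
formula for cosines turns it into a positive superposition of the values at `x + aη` and `x - aη`.
-/
lemma CosTransformNonneg.paretoCharFun_mul {H : ℝ → ℝ} (hH : CosTransformNonneg H)
    (hi : Integrable H) {s : ℝ} (hs : 0 < s) (a : ℝ) :
    CosTransformNonneg (fun w => paretoCharFun s (a * w) * H w) := by
  intro x
  have hprod : Integrable (Function.uncurry fun (w η : ℝ) =>
      (Real.cos (w * x) * Real.cos (a * w * η)) * (H w * η ^ (-(1 + 2 * s))))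
      (volume.prod (volume.restrict (Ioi 1))) := by
    refine (Integrable.mul_prod hi (integrableOn_pareto hs)).bdd_mul (c := 1)
      (f := fun z : ℝ × ℝ => Real.cos (z.1 * x) * Real.cos (a * z.1 * z.2))
      (by fun_prop) (ae_of_all _ fun z => ?_)
    rw [norm_mul]
    exact mul_le_one₀ (Real.abs_cos_le_one _) (norm_nonneg _) (Real.abs_cos_le_one _)
  have hswap := integral_integral_swap hprod
  have hL : ∀ w, Real.cos (w * x) * (paretoCharFun s (a * w) * H w) =
      2 * s * ∫ η in Ioi (1 : ℝ),
        (Real.cos (w * x) * Real.cos (a * w * η)) * (H w * η ^ (-(1 + 2 * s))) := by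
    intro w
    rw [paretoCharFun, show ∀ I : ℝ, Real.cos (w * x) * (2 * s * I * H w) =
      2 * s * ((Real.cos (w * x) * H w) * I) by intro I; ring, ← integral_const_mul]
    congr 2
    ext η
    ring
  simp only [hL]
  rw [integral_const_mul, hswap]
  refine mul_nonneg (by positivity) (setIntegral_nonneg measurableSet_Ioi fun η hη => ?_)
  have hη : 0 < η := zero_lt_one.trans hη
  have hcosH : ∀ y, Integrable fun w => Real.cos (w * y) * H w := fun y =>
    hi.bdd_mul (c := 1) (by fun_prop : Continuous fun w => Real.cos (w * y)).aestronglyMeasurable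
      (ae_of_all _ fun η => Real.abs_cos_le_one _)
  have hE : ∀ w, (Real.cos (w * x) * Real.cos (a * w * η)) * (H w * η ^ (-(1 + 2 * s))) =
      η ^ (-(1 + 2 * s)) / 2 * (Real.cos (w * (x + a * η)) * H w +
        Real.cos (w * (x - a * η)) * H w) := by
    intro w
    rw [mul_add w, mul_sub w, Real.cos_add, Real.cos_sub, show a * w * η = w * (a * η) by ring]
    ring
  simp only [hE]
  rw [integral_const_mul, integral_add (hcosH _) (hcosH _)]
  have h1 := hH (x + a * η)
  have h2 := hH (x - a * η)
  positivity

lemma CosTransformNonneg.of_tendsto {H : ℕ → ℝ → ℝ} {G B : ℝ → ℝ}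
    (hH : ∀ n, CosTransformNonneg (H n)) (hm : ∀ n, AEStronglyMeasurable (H n))
    (hB : Integrable B) (hb : ∀ n w, |H n w| ≤ B w)
    (hl : ∀ᵐ w, Tendsto (fun n => H n w) atTop (𝓝 (G w))) : CosTransformNonneg G := by
  intro x
  refine ge_of_tendsto' (tendsto_integral_of_dominated_convergence
    (F := fun n w => Real.cos (w * x) * H n w) B (fun n => ?_) hB (fun n => ?_) ?_)
    (fun n => hH n x)
  · exact (by fun_prop : Continuous fun w => Real.cos (w * x)).aestronglyMeasurable.mul (hm n)
  · refine ae_of_all _ fun w => ?_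
    rw [norm_mul]
    exact (mul_le_of_le_one_left (norm_nonneg _) (Real.abs_cos_le_one _)).trans (hb n w)
  · filter_upwards [hl] with w hw
    exact hw.const_mul _

/-- The scaling under which powers of the Pareto characteristic function converge to
`exp (-|w|^(2s))`. -/
def paretoScale (s : ℝ) (n : ℕ) : ℝ := (2 * s * cosLevyIntegral s * n) ^ (-(1 / (2 * s)))

/-- The stable limit theorem. It follows from `(1 + a_n)^n → exp a` whenever `n a_n → a`; the scale
is tuned so that the powers of `n` and the constant `cosLevyIntegral s` cancel. -/
lemma tendsto_paretoCharFun_pow {s : ℝ} (hs : 0 < s) (hs' : s < 1) {w : ℝ} (hw : w ≠ 0) :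
    Tendsto (fun n : ℕ => paretoCharFun s (paretoScale s n * w) ^ n) atTop
      (𝓝 (Real.exp (-|w| ^ (2 * s)))) := by
  have hK := cosLevyIntegral_pos hs hs'
  have heven : ∀ x, paretoCharFun s |x| = paretoCharFun s x := by
    intro x
    rcases abs_choice x with h | h <;> rw [h]
    simp [paretoCharFun]
  have hpos : ∀ n : ℕ, n ≠ 0 → 0 < paretoScale s n := by
    intro n hn
    have : (0 : ℝ) < n := by positivity
    unfold paretoScale
    positivity
  have hscale : ∀ n : ℕ, n ≠ 0 →
      n * (2 * s * (paretoScale s n * |w|) ^ (2 * s)) = |w| ^ (2 * s) / cosLevyIntegral s := by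
    intro n hn
    have hn' : (0 : ℝ) < n := by positivity
    rw [Real.mul_rpow (hpos n hn).le (abs_nonneg _), paretoScale, ← Real.rpow_mul (by positivity),
      show -(1 / (2 * s)) * (2 * s) = -1 by field_simp, Real.rpow_neg_one]
    field_simp
  have hlim0 : Tendsto (fun n : ℕ => paretoScale s n * |w|) atTop (𝓝 0) := by
    rw [← zero_mul |w|]
    refine Tendsto.mul_const _ ((tendsto_rpow_neg_atTop (by positivity)).comp ?_)
    exact Tendsto.const_mul_atTop (by positivity) tendsto_natCast_atTop_atTop
  have hI : Tendsto (fun n : ℕ => ∫ η in Ioi (paretoScale s n * |w|),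
      (1 - Real.cos η) / η ^ (1 + 2 * s)) atTop (𝓝 (cosLevyIntegral s)) := by
    have h := (aecover_Ioi_of_Ioi (μ := volume) hlim0).integral_tendsto_of_countably_generated
      (integrableOn_one_sub_cos_div hs hs')
    refine h.congr' ?_
    filter_upwards [eventually_ne_atTop 0] with n hn
    rw [Measure.restrict_restrict measurableSet_Ioi, Ioi_inter_Ioi,
      sup_of_le_left (mul_nonneg (hpos n hn).le (abs_nonneg _))]
  have key : Tendsto (fun n : ℕ => n * (paretoCharFun s (paretoScale s n * w) - 1)) atTop
      (𝓝 (-|w| ^ (2 * s))) := by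
    have h := (hI.const_mul (|w| ^ (2 * s) / cosLevyIntegral s)).neg
    rw [div_mul_cancel₀ _ hK.ne'] at h
    refine h.congr' ?_
    filter_upwards [eventually_ne_atTop 0] with n hn
    have hw' : 0 < paretoScale s n * |w| := mul_pos (hpos n hn) (abs_pos.2 hw)
    rw [← heven (paretoScale s n * w), abs_mul, abs_of_pos (hpos n hn), paretoCharFun_eq hs hw',
      ← hscale n hn]
    ring
  have := Real.tendsto_one_add_pow_exp_of_tendsto key
  simpa using this

/-- Since `2s ≥ 1`, the exponent dominates `|w| - 1`, and `exp(-|w|)` is at most `2/(1 + w²)`. -/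
lemma integrable_exp_neg_rpow {s : ℝ} (hs : 1 / 2 < s) :
    Integrable fun w : ℝ => Real.exp (-|w| ^ (2 * s)) := by
  refine (integrable_inv_one_add_sq.const_mul (2 * Real.exp 1)).mono'
    (Measurable.aestronglyMeasurable (by fun_prop)) (ae_of_all _ fun w => ?_)
  rw [Real.norm_of_nonneg (Real.exp_pos _).le]
  have h1 : |w| - 1 ≤ |w| ^ (2 * s) := by
    rcases le_total |w| 1 with h | h
    · have : 0 ≤ |w| ^ (2 * s) := by positivity
      linarith
    · have := Real.rpow_le_rpow_of_exponent_le h (by linarith : 1 ≤ 2 * s)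
      rw [Real.rpow_one] at this
      linarith
  have h2 : 1 + w ^ 2 ≤ 2 * Real.exp |w| := by
    have := Real.quadratic_le_exp_of_nonneg (abs_nonneg w)
    rw [sq_abs] at this
    nlinarith [abs_nonneg w]
  calc Real.exp (-|w| ^ (2 * s)) ≤ Real.exp (1 - |w|) := Real.exp_le_exp.2 (by linarith)
    _ = Real.exp 1 * (Real.exp |w|)⁻¹ := by rw [sub_eq_add_neg, Real.exp_add, Real.exp_neg]
    _ ≤ Real.exp 1 * (2 * (1 + w ^ 2)⁻¹) := by
        gcongr
        rw [inv_le_iff_one_le_mul₀ (Real.exp_pos _)]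
        have : (0 : ℝ) < 1 + w ^ 2 := by positivity
        field_simp
        linarith
    _ = _ := by ring

/-- The powers of the Pareto characteristic function are bounded by one, but no integrable majorant
is at hand. A Gaussian factor supplies one while `n → ∞`, and is removed afterwards by letting its
parameter tend to zero. -/
lemma cosTransformNonneg_exp_neg_rpow {s : ℝ} (hs : 1 / 2 < s) (hs' : s < 1) :
    CosTransformNonneg fun w => Real.exp (-|w| ^ (2 * s)) := by
  have hs0 : 0 < s := by linarith
  have hpow : ∀ (a b : ℝ) (_ : 0 < b) (n : ℕ),
      CosTransformNonneg (fun w => paretoCharFun s (a * w) ^ n * Real.exp (-b * w ^ 2)) ∧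
      Integrable (fun w => paretoCharFun s (a * w) ^ n * Real.exp (-b * w ^ 2)) := by
    intro a b hb n
    induction n with
    | zero =>
      simpa only [pow_zero, one_mul] using
        And.intro (cosTransformNonneg_gaussian hb) (integrable_exp_neg_mul_sq hb)
    | succ n ih =>
      simp only [pow_succ' (paretoCharFun s _), mul_assoc (paretoCharFun s _)]
      refine ⟨ih.1.paretoCharFun_mul ih.2 hs0 a, ih.2.bdd_mul (c := 1)
        ((measurable_paretoCharFun s).comp (measurable_const_mul a)).aestronglyMeasurable
        (ae_of_all _ fun w => abs_paretoCharFun_le_one hs0 _)⟩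
  have hgauss : ∀ b : ℝ, 0 < b →
      CosTransformNonneg fun w => Real.exp (-|w| ^ (2 * s)) * Real.exp (-b * w ^ 2) := by
    intro b hb
    refine CosTransformNonneg.of_tendsto (B := fun w => Real.exp (-b * w ^ 2))
      (fun n => (hpow (paretoScale s n) b hb n).1)
      (fun n => (hpow (paretoScale s n) b hb n).2.aestronglyMeasurable)
      (integrable_exp_neg_mul_sq hb) (fun n w => ?_) ?_
    · rw [abs_mul, abs_pow, Real.abs_exp]
      exact mul_le_of_le_one_left (Real.exp_pos _).le
        (pow_le_one₀ (abs_nonneg _) (abs_paretoCharFun_le_one hs0 _))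
    · filter_upwards [compl_mem_ae_iff.2 (measure_singleton (0 : ℝ))] with w hw
      exact (tendsto_paretoCharFun_pow hs0 hs' hw).mul_const _
  refine CosTransformNonneg.of_tendsto (B := fun w => Real.exp (-|w| ^ (2 * s)))
    (fun n : ℕ => hgauss (1 / ((n : ℝ) + 1)) (by positivity))
    (fun n => Measurable.aestronglyMeasurable (by fun_prop)) (integrable_exp_neg_rpow hs)
    (fun n w => ?_) (ae_of_all _ fun w => ?_)
  · rw [abs_mul, Real.abs_exp, Real.abs_exp]
    refine mul_le_of_le_one_right (Real.exp_pos _).le (Real.exp_le_one_iff.2 ?_)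
    have : (0 : ℝ) ≤ 1 / ((n : ℝ) + 1) := by positivity
    nlinarith [sq_nonneg w]
  · have h1 : Tendsto (fun n : ℕ => -(1 / ((n : ℝ) + 1)) * w ^ 2) atTop (𝓝 0) := by
      have := (tendsto_one_div_add_atTop_nhds_zero_nat (𝕜 := ℝ)).neg.mul_const (w ^ 2)
      simpa using this
    have h2 := ((Real.continuous_exp.tendsto 0).comp h1).const_mul (Real.exp (-|w| ^ (2 * s)))
    simpa using h2

/-! ### The stable density: scaling, integrability, characteristic function. -/

/-- The density `P_s(·, 1)` of the symmetric `2s`-stable law. -/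
def stableDensity (s x : ℝ) : ℝ := fracHeatKernel s x 1

/-- The self-similar scaling factor `t^(1/(2s))`. -/
def timeScale (s t : ℝ) : ℝ := t ^ (1 / (2 * s))

lemma timeScale_pos (s : ℝ) {t : ℝ} (ht : 0 < t) : 0 < timeScale s t := Real.rpow_pos_of_pos ht _

lemma timeScale_nonneg (s : ℝ) {t : ℝ} (ht : 0 ≤ t) : 0 ≤ timeScale s t := Real.rpow_nonneg ht _

lemma timeScale_zero {s : ℝ} (hs : 0 < s) : timeScale s 0 = 0 :=
  Real.zero_rpow (by positivity)

lemma continuous_timeScale {s : ℝ} (hs : 0 < s) : Continuous (timeScale s) :=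
  Real.continuous_rpow_const (by positivity)

lemma timeScale_mul_rpow {s : ℝ} (hs : 0 < s) {t : ℝ} (ht : 0 ≤ t) (b : ℝ) :
    |timeScale s t * b| ^ (2 * s) = t * |b| ^ (2 * s) := by
  rw [abs_mul, abs_of_nonneg (timeScale_nonneg s ht), Real.mul_rpow (timeScale_nonneg s ht)
    (abs_nonneg _), timeScale, ← Real.rpow_mul ht, one_div_mul_cancel (by positivity),
    Real.rpow_one]

lemma integrable_exp_neg_mul_abs_rpow {s : ℝ} (hs : 1 / 2 < s) {t : ℝ} (ht : 0 < t) :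
    Integrable fun w : ℝ => Real.exp (-(t * |w| ^ (2 * s))) := by
  have h := (integrable_exp_neg_rpow hs).comp_mul_left' (timeScale_pos s ht).ne'
  simpa only [timeScale_mul_rpow (by linarith : 0 < s) ht.le] using h

lemma fracHeatKernel_eq {s : ℝ} (hs : 1 / 2 < s) {t : ℝ} (ht : 0 < t) (x : ℝ) :
    fracHeatKernel s x t =
      (2 * Real.pi)⁻¹ * ∫ w, Real.cos (w * x) * Real.exp (-(t * |w| ^ (2 * s))) := by
  have hi : Integrable fun w : ℝ => Real.exp (-(t * |2 * Real.pi * w| ^ (2 * s))) :=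
    (integrable_exp_neg_mul_abs_rpow hs ht).comp_mul_left' (by positivity : 2 * Real.pi ≠ 0)
  have hint : Integrable fun w : ℝ => Complex.exp (↑(2 * Real.pi * inner ℝ w x) * Complex.I) •
      ((Real.exp (-(t * |2 * Real.pi * w| ^ (2 * s))) : ℝ) : ℂ) := by
    refine (hi.ofReal (𝕜 := ℂ)).bdd_mul (c := 1) (by fun_prop) (ae_of_all _ fun w => ?_)
    rw [Complex.norm_exp_ofReal_mul_I]
  rw [fracHeatKernel, Real.fourierInv_eq', ← RCLike.re_eq_complex_re, ← integral_re hint]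
  have h := Measure.integral_comp_mul_left
    (fun w => Real.cos (w * x) * Real.exp (-(t * |w| ^ (2 * s)))) (2 * Real.pi)
  rw [abs_of_pos (by positivity), smul_eq_mul] at h
  rw [← h]
  congr 1
  ext w
  rw [smul_eq_mul, RCLike.re_eq_complex_re, Complex.re_mul_ofReal, Complex.exp_ofReal_mul_I_re]
  congr 2
  simp
  ring

lemma stableDensity_eq {s : ℝ} (hs : 1 / 2 < s) (x : ℝ) :
    stableDensity s x = (2 * Real.pi)⁻¹ * ∫ w, Real.cos (w * x) * Real.exp (-|w| ^ (2 * s)) := by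
  rw [stableDensity, fracHeatKernel_eq hs one_pos]
  simp only [one_mul]

lemma fracHeatKernel_eq_stableDensity {s : ℝ} (hs : 1 / 2 < s) {t : ℝ} (ht : 0 < t) (x : ℝ) :
    fracHeatKernel s x t = (timeScale s t)⁻¹ * stableDensity s ((timeScale s t)⁻¹ * x) := by
  have hc := timeScale_pos s ht
  rw [fracHeatKernel_eq hs ht, stableDensity_eq hs]
  have h := Measure.integral_comp_mul_left
    (fun w => Real.cos (w * ((timeScale s t)⁻¹ * x)) * Real.exp (-|w| ^ (2 * s))) (timeScale s t)
  rw [abs_of_pos (inv_pos.2 hc), smul_eq_mul] at h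
  rw [mul_left_comm, ← h]
  congr 2
  ext w
  rw [timeScale_mul_rpow (by linarith : 0 < s) ht.le]
  congr 2
  field_simp

lemma stableDensity_nonneg {s : ℝ} (hs : 1 / 2 < s) (hs' : s < 1) (x : ℝ) :
    0 ≤ stableDensity s x := by
  rw [stableDensity_eq hs]
  exact mul_nonneg (by positivity) (cosTransformNonneg_exp_neg_rpow hs hs' x)

lemma continuous_stableDensity {s : ℝ} (hs : 1 / 2 < s) : Continuous (stableDensity s) := by
  simp only [funext (stableDensity_eq hs)]
  refine continuous_const.mul (continuous_of_dominated
    (bound := fun w => Real.exp (-|w| ^ (2 * s))) (fun x => ?_) (fun x => ?_)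
    (integrable_exp_neg_rpow hs) (ae_of_all _ fun w => by fun_prop))
  · exact Measurable.aestronglyMeasurable (by fun_prop)
  · refine ae_of_all _ fun w => ?_
    rw [norm_mul, Real.norm_of_nonneg (Real.exp_pos _).le]
    exact mul_le_of_le_one_left (Real.exp_pos _).le (Real.abs_cos_le_one _)

/-- Fubini moves the Gaussian to the frequency side, where `exp(-|w|^(2s)) ≤ 1`. The two Gaussian
masses multiply to `2π` for every `b`, so the bound is uniform in `b`. -/
lemma integral_stableDensity_mul_gaussian_le {s : ℝ} (hs : 1 / 2 < s) {b : ℝ} (hb : 0 < b) :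
    ∫ x, stableDensity s x * Real.exp (-b * x ^ 2) ≤ 1 := by
  have hprod : Integrable (Function.uncurry fun (x w : ℝ) =>
      Real.cos (w * x) * (Real.exp (-b * x ^ 2) * Real.exp (-|w| ^ (2 * s))))
      (volume.prod volume) := by
    refine (Integrable.mul_prod (integrable_exp_neg_mul_sq hb) (integrable_exp_neg_rpow hs)).bdd_mul
      (c := 1) (f := fun z : ℝ × ℝ => Real.cos (z.2 * z.1)) (by fun_prop)
      (ae_of_all _ fun z => Real.abs_cos_le_one _)
  have hswap := integral_integral_swap hprod
  have h1 : ∀ x, stableDensity s x * Real.exp (-b * x ^ 2) = (2 * Real.pi)⁻¹ *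
      ∫ w, Real.cos (w * x) * (Real.exp (-b * x ^ 2) * Real.exp (-|w| ^ (2 * s))) := by
    intro x
    rw [stableDensity_eq hs, mul_assoc, ← integral_mul_const]
    congr 2
    ext w
    ring
  have h2 : ∀ w, ∫ x, Real.cos (w * x) * (Real.exp (-b * x ^ 2) * Real.exp (-|w| ^ (2 * s))) =
      √(Real.pi / b) * (Real.exp (-(1 / (4 * b)) * w ^ 2) * Real.exp (-|w| ^ (2 * s))) := by
    intro w
    simp only [← mul_assoc]
    rw [integral_mul_const, integral_cos_mul_gaussian hb]
    congr 3
    ring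
  simp only [h1]
  rw [integral_const_mul, hswap]
  simp only [h2]
  rw [integral_const_mul]
  have hb' : 0 < 1 / (4 * b) := by positivity
  have h3 : ∫ w, Real.exp (-(1 / (4 * b)) * w ^ 2) * Real.exp (-|w| ^ (2 * s)) ≤
      √(Real.pi / (1 / (4 * b))) := by
    rw [← integral_gaussian]
    refine integral_mono_of_nonneg (ae_of_all _ fun w => by positivity)
      (integrable_exp_neg_mul_sq hb') (ae_of_all _ fun w => ?_)
    refine mul_le_of_le_one_right (Real.exp_pos _).le (Real.exp_le_one_iff.2 ?_)
    have : 0 ≤ |w| ^ (2 * s) := by positivity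
    linarith
  calc _ ≤ (2 * Real.pi)⁻¹ * (√(Real.pi / b) * √(Real.pi / (1 / (4 * b)))) := by gcongr
    _ = 1 := by
      rw [← Real.sqrt_mul (by positivity),
        show Real.pi / b * (Real.pi / (1 / (4 * b))) = (2 * Real.pi) ^ 2 by field_simp; ring,
        Real.sqrt_sq (by positivity)]
      field_simp

/-- Positivity replaces any decay estimate: on `[-n, n]` the factor `e · exp(-x²/n²)` is at least
one, so the uniform Gaussian-weighted bound controls the integral there by `e`. -/
lemma integrable_stableDensity {s : ℝ} (hs : 1 / 2 < s) (hs' : s < 1) :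
    Integrable (stableDensity s) := by
  have hc := continuous_stableDensity hs
  refine integrable_of_intervalIntegral_norm_bounded (l := atTop) (a := fun n : ℕ => -(n : ℝ))
    (b := fun n : ℕ => (n : ℝ)) (Real.exp 1) (fun n => (hc.integrableOn_Ioc))
    (tendsto_neg_atTop_atBot.comp tendsto_natCast_atTop_atTop) tendsto_natCast_atTop_atTop ?_
  filter_upwards [eventually_gt_atTop 0] with n hn
  have hn' : (0 : ℝ) < n := by exact_mod_cast hn
  have hb : 0 < 1 / (n : ℝ) ^ 2 := by positivity
  have hbd : ∃ C, ∀ x, ‖stableDensity s x‖ ≤ C := by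
    refine ⟨(2 * Real.pi)⁻¹ * ∫ w, Real.exp (-|w| ^ (2 * s)), fun x => ?_⟩
    rw [stableDensity_eq hs, norm_mul, Real.norm_of_nonneg (by positivity : 0 ≤ (2 * Real.pi)⁻¹)]
    gcongr
    refine norm_integral_le_of_norm_le (integrable_exp_neg_rpow hs) (ae_of_all _ fun w => ?_)
    rw [norm_mul, Real.norm_of_nonneg (Real.exp_pos _).le]
    exact mul_le_of_le_one_left (Real.exp_pos _).le (Real.abs_cos_le_one _)
  obtain ⟨C, hC⟩ := hbd
  have hint : Integrable fun x => Real.exp 1 *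
      (stableDensity s x * Real.exp (-(1 / (n : ℝ) ^ 2) * x ^ 2)) :=
    (integrable_gaussian_mul hb hc hC).const_mul _
  have h0 : ∀ x, 0 ≤ Real.exp 1 * (stableDensity s x * Real.exp (-(1 / (n : ℝ) ^ 2) * x ^ 2)) :=
    fun x => mul_nonneg (Real.exp_pos _).le
      (mul_nonneg (stableDensity_nonneg hs hs' x) (Real.exp_pos _).le)
  rw [intervalIntegral.integral_of_le (by linarith)]
  calc ∫ x in Ioc (-(n : ℝ)) n, ‖stableDensity s x‖
      ≤ ∫ x in Ioc (-(n : ℝ)) n, Real.exp 1 *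
        (stableDensity s x * Real.exp (-(1 / (n : ℝ) ^ 2) * x ^ 2)) := by
        refine setIntegral_mono_on hc.norm.integrableOn_Ioc hint.integrableOn measurableSet_Ioc
          fun x hx => ?_
        rw [Real.norm_of_nonneg (stableDensity_nonneg hs hs' x), mul_left_comm, ← Real.exp_add]
        refine le_mul_of_one_le_right (stableDensity_nonneg hs hs' x) (Real.one_le_exp ?_)
        have : x ^ 2 ≤ (n : ℝ) ^ 2 := sq_le_sq' hx.1.le hx.2
        have : 1 / (n : ℝ) ^ 2 * x ^ 2 ≤ 1 := by
          rw [one_div_mul_eq_div]; exact div_le_one_of_le₀ this (by positivity)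
        linarith
    _ ≤ ∫ x, Real.exp 1 * (stableDensity s x * Real.exp (-(1 / (n : ℝ) ^ 2) * x ^ 2)) :=
        setIntegral_le_integral hint (ae_of_all _ h0)
    _ = Real.exp 1 * ∫ x, stableDensity s x * Real.exp (-(1 / (n : ℝ) ^ 2) * x ^ 2) :=
        integral_const_mul _ _
    _ ≤ Real.exp 1 * 1 := by gcongr; exact integral_stableDensity_mul_gaussian_le hs hb
    _ = _ := mul_one _

lemma fourierInv_stable {s : ℝ} (hs : 1 / 2 < s) (x : ℝ) :
    𝓕⁻ (fun w : ℝ => ((Real.exp (-|2 * Real.pi * w| ^ (2 * s)) : ℝ) : ℂ)) x =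
      (stableDensity s x : ℂ) := by
  have hi : Integrable fun w : ℝ => Real.exp (-|2 * Real.pi * w| ^ (2 * s)) :=
    (integrable_exp_neg_rpow hs).comp_mul_left' (by positivity : 2 * Real.pi ≠ 0)
  have hint : Integrable fun w : ℝ => Complex.exp (↑(2 * Real.pi * inner ℝ w x) * Complex.I) •
      ((Real.exp (-|2 * Real.pi * w| ^ (2 * s)) : ℝ) : ℂ) := by
    refine (hi.ofReal (𝕜 := ℂ)).bdd_mul (c := 1) (by fun_prop) (ae_of_all _ fun w => ?_)
    rw [Complex.norm_exp_ofReal_mul_I]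
  apply Complex.ext
  · rw [Complex.ofReal_re, stableDensity, fracHeatKernel]
    simp only [one_mul]
  -- The imaginary part is the integral of an odd function, hence zero.
  · rw [Complex.ofReal_im, Real.fourierInv_eq', ← RCLike.im_eq_complex_im, ← integral_im hint]
    have h : ∀ w : ℝ, RCLike.im (Complex.exp (↑(2 * Real.pi * inner ℝ w x) * Complex.I) •
        ((Real.exp (-|2 * Real.pi * w| ^ (2 * s)) : ℝ) : ℂ)) =
        Real.sin (2 * Real.pi * inner ℝ w x) * Real.exp (-|2 * Real.pi * w| ^ (2 * s)) := by
      intro w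
      rw [smul_eq_mul, RCLike.im_eq_complex_im, Complex.im_mul_ofReal,
        Complex.exp_ofReal_mul_I_im]
    simp only [h]
    have hodd := integral_neg_eq_self (fun w : ℝ => Real.sin (2 * Real.pi * inner ℝ w x) *
      Real.exp (-|2 * Real.pi * w| ^ (2 * s))) volume
    simp only [inner_neg_left, mul_neg, Real.sin_neg, abs_neg, neg_mul, integral_neg] at hodd
    linarith

/-- Fourier inversion, legitimate now that both the density and its transform are integrable. The
case `b = 0` is mass one. -/
lemma integral_stableDensity_mul_cexp {s : ℝ} (hs : 1 / 2 < s) (hs' : s < 1) (b : ℝ) :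
    ∫ y, Complex.exp ((-(b * y) : ℝ) * Complex.I) * (stableDensity s y : ℂ) =
      ((Real.exp (-|b| ^ (2 * s)) : ℝ) : ℂ) := by
  set g : ℝ → ℂ := fun w : ℝ => ((Real.exp (-|2 * Real.pi * w| ^ (2 * s)) : ℝ) : ℂ) with hg
  have hi : Integrable g := Integrable.ofReal (𝕜 := ℂ)
    ((integrable_exp_neg_rpow hs).comp_mul_left' (by positivity : 2 * Real.pi ≠ 0))
  have hgc : Continuous g := by
    have : Continuous fun x : ℝ => x ^ (2 * s) := Real.continuous_rpow_const (by linarith)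
    have h2 : Continuous fun w : ℝ => |2 * Real.pi * w| ^ (2 * s) := this.comp (by fun_prop)
    exact Complex.continuous_ofReal.comp (Real.continuous_exp.comp h2.neg)
  have hinv : 𝓕⁻ g = fun x => (stableDensity s x : ℂ) := funext (fourierInv_stable hs)
  have hF : Integrable (𝓕 g) := by
    have h : 𝓕 g = fun x => (stableDensity s (-x) : ℂ) := by
      ext x
      rw [← fourierInv_stable hs (-x), Real.fourierInv_eq_fourier_neg, neg_neg]
    rw [h]
    exact ((integrable_stableDensity hs hs').comp_neg).ofReal
  have h := congrFun (hgc.fourier_fourierInv_eq hi hF) (b / (2 * Real.pi))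
  rw [hinv, Real.fourier_real_eq_integral_exp_smul] at h
  have hb : 2 * Real.pi * (b / (2 * Real.pi)) = b := by field_simp
  rw [hg] at h
  dsimp only at h
  rw [hb] at h
  rw [← h]
  congr 1
  ext y
  rw [smul_eq_mul, show -2 * Real.pi * y * (b / (2 * Real.pi)) =
    -(2 * Real.pi * (b / (2 * Real.pi)) * y) by ring, hb]

lemma integral_stableDensity {s : ℝ} (hs : 1 / 2 < s) (hs' : s < 1) :
    ∫ y, stableDensity s y = 1 := by
  have h := integral_stableDensity_mul_cexp hs hs' 0
  have h0 : (0 : ℝ) ^ (2 * s) = 0 := Real.zero_rpow (by linarith)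
  simp only [zero_mul, neg_zero, Complex.ofReal_zero, Complex.exp_zero, one_mul, abs_zero, h0,
    Real.exp_zero, Complex.ofReal_one] at h
  rw [integral_complex_ofReal] at h
  exact_mod_cast h

/-! ### The semigroup: basic properties and the kernel formula. -/

/-- The solution operator of the one-dimensional fractional heat equation, written in
self-similar variables so that it makes sense at `t = 0` as well. -/
def stableSemigroup (s : ℝ) (f : ℝ → ℝ) (x t : ℝ) : ℝ :=
  ∫ y, stableDensity s y * f (x - timeScale s t * y)

section Basic

variable {s : ℝ} {f : ℝ → ℝ} {C : ℝ}

lemma integrable_stableDensity_mul (hs : 1 / 2 < s) (hs' : s < 1) {g : ℝ → ℝ}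
    (hg : AEStronglyMeasurable g) (hC : ∀ x, |g x| ≤ C) :
    Integrable fun y => stableDensity s y * g y :=
  (integrable_stableDensity hs hs').mul_bdd hg (ae_of_all _ hC)

lemma integrable_stableSemigroup (hs : 1 / 2 < s) (hs' : s < 1) (hf : Continuous f)
    (hC : ∀ x, |f x| ≤ C) (x t : ℝ) :
    Integrable fun y => stableDensity s y * f (x - timeScale s t * y) :=
  integrable_stableDensity_mul hs hs' (by fun_prop : Continuous _).aestronglyMeasurable
    fun _ => hC _

lemma norm_stableDensity_mul_le (hs : 1 / 2 < s) (hs' : s < 1) (y : ℝ) {a : ℝ} (ha : |a| ≤ C) :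
    ‖stableDensity s y * a‖ ≤ stableDensity s y * C := by
  rw [norm_mul, Real.norm_of_nonneg (stableDensity_nonneg hs hs' y)]
  exact mul_le_mul_of_nonneg_left ha (stableDensity_nonneg hs hs' y)

lemma abs_stableSemigroup_le (hs : 1 / 2 < s) (hs' : s < 1)
    (hC : ∀ x, |f x| ≤ C) (x t : ℝ) : |stableSemigroup s f x t| ≤ C := by
  have h := norm_integral_le_of_norm_le
    (f := fun y => stableDensity s y * f (x - timeScale s t * y))
    ((integrable_stableDensity hs hs').mul_const C)
    (ae_of_all _ fun y => norm_stableDensity_mul_le hs hs' y (hC _))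
  rwa [integral_mul_const, integral_stableDensity hs hs', one_mul] at h

lemma continuous_stableSemigroup (hs : 1 / 2 < s) (hs' : s < 1) (hf : Continuous f)
    (hC : ∀ x, |f x| ≤ C) : Continuous fun p : ℝ × ℝ => stableSemigroup s f p.1 p.2 := by
  have hc := continuous_timeScale (by linarith : 0 < s)
  refine continuous_of_dominated (bound := fun y => stableDensity s y * C)
    (fun p => (integrable_stableSemigroup hs hs' hf hC p.1 p.2).aestronglyMeasurable)
    (fun p => ae_of_all _ fun y => norm_stableDensity_mul_le hs hs' y (hC _))
    ((integrable_stableDensity hs hs').mul_const C) (ae_of_all _ fun y => ?_)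
  fun_prop

lemma stableSemigroup_zero (hs : 1 / 2 < s) (hs' : s < 1) (f : ℝ → ℝ) (x : ℝ) :
    stableSemigroup s f x 0 = f x := by
  simp [stableSemigroup, timeScale_zero (by linarith : 0 < s), integral_mul_const,
    integral_stableDensity hs hs']

lemma monotone_stableSemigroup (hs : 1 / 2 < s) (hs' : s < 1) (hf : Continuous f)
    (hC : ∀ x, |f x| ≤ C) (hm : Monotone f) (t : ℝ) :
    Monotone fun x => stableSemigroup s f x t := by
  intro x x' hx
  refine integral_mono (integrable_stableSemigroup hs hs' hf hC x t)
    (integrable_stableSemigroup hs hs' hf hC x' t) fun y => ?_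
  exact mul_le_mul_of_nonneg_left (hm (by linarith)) (stableDensity_nonneg hs hs' y)

lemma tendsto_stableSemigroup (hs : 1 / 2 < s) (hs' : s < 1) {F : ℕ → ℝ → ℝ}
    (hF : ∀ n, Continuous (F n)) (hC : ∀ n x, |F n x| ≤ C)
    (hl : ∀ x, Tendsto (fun n => F n x) atTop (𝓝 (f x))) (x t : ℝ) :
    Tendsto (fun n => stableSemigroup s (F n) x t) atTop (𝓝 (stableSemigroup s f x t)) :=
  tendsto_integral_of_dominated_convergence (fun y => stableDensity s y * C)
    (fun n => (integrable_stableSemigroup hs hs' (hF n) (hC n) x t).aestronglyMeasurable)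
    ((integrable_stableDensity hs hs').mul_const C)
    (fun n => ae_of_all _ fun y => norm_stableDensity_mul_le hs hs' y (hC n _))
    (ae_of_all _ fun _ => (hl _).const_mul _)

lemma fracHeatKernel_mul_eq (hs : 1 / 2 < s) {t : ℝ} (ht : 0 < t) (f : ℝ → ℝ) (x y : ℝ) :
    fracHeatKernel s (x - (x - y)) t * f (x - y) = (timeScale s t)⁻¹ *
      (stableDensity s ((timeScale s t)⁻¹ * y) *
        f (x - timeScale s t * ((timeScale s t)⁻¹ * y))) := by
  rw [sub_sub_cancel, fracHeatKernel_eq_stableDensity hs ht,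
    mul_inv_cancel_left₀ (timeScale_pos s ht).ne', mul_assoc]

lemma integrable_fracHeatKernel_mul (hs : 1 / 2 < s) (hs' : s < 1) (hf : Continuous f)
    (hC : ∀ x, |f x| ≤ C) (x : ℝ) {t : ℝ} (ht : 0 < t) :
    Integrable fun r => fracHeatKernel s (x - r) t * f r := by
  have h := ((integrable_stableSemigroup hs hs' hf hC x t).comp_mul_left'
    (inv_pos.2 (timeScale_pos s ht)).ne').const_mul (timeScale s t)⁻¹
  simp only [← fracHeatKernel_mul_eq hs ht] at h
  simpa only [sub_sub_cancel] using h.comp_sub_left x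

lemma integral_fracHeatKernel_mul (hs : 1 / 2 < s) (f : ℝ → ℝ) (x : ℝ) {t : ℝ} (ht : 0 < t) :
    ∫ r, fracHeatKernel s (x - r) t * f r = stableSemigroup s f x t := by
  rw [← integral_sub_left_eq_self _ volume x]
  simp only [fracHeatKernel_mul_eq hs ht]
  have hc := timeScale_pos s ht
  rw [integral_const_mul, Measure.integral_comp_mul_left
    (fun y => stableDensity s y * f (x - timeScale s t * y)), inv_inv, abs_of_pos hc, smul_eq_mul,
    inv_mul_cancel_left₀ hc.ne', stableSemigroup]

lemma IsBddSmooth.hasDerivAt_stableSemigroup (hs : 1 / 2 < s) (hs' : s < 1) (hf : IsBddSmooth f)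
    (x t : ℝ) : HasDerivAt (fun x => stableSemigroup s f x t)
      (stableSemigroup s (_root_.deriv f) x t) x := by
  obtain ⟨C, -, hC⟩ := hf.exists_bound
  obtain ⟨C', -, hC'⟩ := hf.deriv.exists_bound
  refine (hasDerivAt_integral_of_dominated_loc_of_deriv_le
    (bound := fun y => stableDensity s y * C') (s := univ)
    (F' := fun x y => stableDensity s y * _root_.deriv f (x - timeScale s t * y)) univ_mem
    (Eventually.of_forall fun x =>
      (integrable_stableSemigroup hs hs' hf.continuous hC x t).aestronglyMeasurable)
    (integrable_stableSemigroup hs hs' hf.continuous hC x t)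
    (integrable_stableSemigroup hs hs' hf.deriv.continuous hC' x t).aestronglyMeasurable
    (ae_of_all _ fun y x _ => norm_stableDensity_mul_le hs hs' y (hC' _))
    ((integrable_stableDensity hs hs').mul_const C') (ae_of_all _ fun y x _ => ?_)).2
  exact ((hf.hasDerivAt _).comp_sub_const x _).const_mul _

end Basic

/-! ### The semigroup and the fractional Laplacian as Fourier multipliers. -/

section Fourier

/-- The real part of the inverse Fourier integral of `h`. -/
def fourierSuperposition (h : ℝ → ℂ) (x : ℝ) : ℝ :=
  ∫ w, (Complex.exp ((2 * Real.pi * w * x : ℝ) * Complex.I) * h w).re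

lemma abs_re_cexp_mul_le (a : ℝ) (z : ℂ) : |(Complex.exp (a * Complex.I) * z).re| ≤ ‖z‖ := by
  refine (Complex.abs_re_le_norm _).trans ?_
  rw [norm_mul, Complex.norm_exp_ofReal_mul_I, one_mul]

variable {s : ℝ} {h : ℝ → ℂ}

lemma integrable_fourierSuperposition (hi : Integrable h) (x : ℝ) :
    Integrable fun w => (Complex.exp ((2 * Real.pi * w * x : ℝ) * Complex.I) * h w).re := by
  refine Integrable.re (hi.bdd_mul (c := 1)
    (f := fun w : ℝ => Complex.exp ((2 * Real.pi * w * x : ℝ) * Complex.I))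
    (by fun_prop) (ae_of_all _ fun w => ?_))
  rw [Complex.norm_exp_ofReal_mul_I]

/-- Plane waves are eigenfunctions of averaging against the density, with eigenvalue its
characteristic function. -/
lemma integral_stableDensity_mul_wave (hs : 1 / 2 < s) (hs' : s < 1) (a b : ℝ) (z : ℂ) :
    ∫ y, stableDensity s y * (Complex.exp ((a - b * y : ℝ) * Complex.I) * z).re =
      Real.exp (-|b| ^ (2 * s)) * (Complex.exp (a * Complex.I) * z).re := by
  have h0 := integral_stableDensity_mul_cexp hs hs' b
  have hint : Integrable fun y : ℝ => Complex.exp (a * Complex.I) * z *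
      (Complex.exp ((-(b * y) : ℝ) * Complex.I) * (stableDensity s y : ℂ)) := by
    refine Integrable.const_mul ((integrable_stableDensity hs hs').ofReal.bdd_mul (c := 1)
      (f := fun y : ℝ => Complex.exp ((-(b * y) : ℝ) * Complex.I))
      (by fun_prop) (ae_of_all _ fun w => ?_)) _
    rw [Complex.norm_exp_ofReal_mul_I]
  have h1 := congrArg (fun I => (Complex.exp (a * Complex.I) * z * I).re) h0
  rw [← integral_const_mul, ← RCLike.re_eq_complex_re, ← integral_re hint,
    RCLike.re_eq_complex_re, Complex.re_mul_ofReal] at h1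
  rw [mul_comm, ← h1]
  congr 1
  ext y
  rw [show Complex.exp (a * Complex.I) * z * (Complex.exp ((-(b * y) : ℝ) * Complex.I) *
    (stableDensity s y : ℂ)) = (Complex.exp (a * Complex.I) * Complex.exp ((-(b * y) : ℝ) *
    Complex.I)) * z * (stableDensity s y : ℂ) by ring, ← Complex.exp_add, ← add_mul,
    ← Complex.ofReal_add, Complex.re_mul_ofReal, ← sub_eq_add_neg,
    mul_comm]

lemma stableSemigroup_fourierSuperposition (hs : 1 / 2 < s) (hs' : s < 1) (hi : Integrable h)
    (x : ℝ) {t : ℝ} (ht : 0 ≤ t) :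
    stableSemigroup s (fourierSuperposition h) x t =
      ∫ w, Real.exp (-(t * |2 * Real.pi * w| ^ (2 * s))) *
        (Complex.exp ((2 * Real.pi * w * x : ℝ) * Complex.I) * h w).re := by
  have hprod : Integrable (Function.uncurry fun (y w : ℝ) => stableDensity s y *
      (Complex.exp ((2 * Real.pi * w * (x - timeScale s t * y) : ℝ) * Complex.I) * h w).re)
      (volume.prod volume) := by
    have h1 := Integrable.mul_prod ((integrable_stableDensity hs hs').ofReal (𝕜 := ℂ)) hi
    have h2 := (h1.bdd_mul (c := 1) (f := fun z : ℝ × ℝ =>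
      Complex.exp ((2 * Real.pi * z.2 * (x - timeScale s t * z.1) : ℝ) * Complex.I))
      (by fun_prop) (ae_of_all _ fun w => by rw [Complex.norm_exp_ofReal_mul_I])).re
    refine h2.congr (ae_of_all _ fun z => ?_)
    simp only [Function.uncurry]
    rw [mul_left_comm, RCLike.re_eq_complex_re]
    exact Complex.re_ofReal_mul _ _
  unfold stableSemigroup fourierSuperposition
  simp only [← integral_const_mul]
  rw [integral_integral_swap hprod]
  congr 1
  ext w
  rw [← timeScale_mul_rpow (by linarith : 0 < s) ht, ← integral_stableDensity_mul_wave hs hs']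
  congr 1
  ext y
  congr 5
  push_cast
  ring

lemma one_sub_cos_le (b η : ℝ) : 2 * (1 - Real.cos (b * η)) ≤ (4 + b ^ 2) * min 1 (η ^ 2) := by
  rcases min_choice 1 (η ^ 2) with h | h <;> rw [h]
  · nlinarith [Real.neg_one_le_cos (b * η), sq_nonneg b]
  · nlinarith [Real.one_sub_sq_div_two_le_cos (x := b * η), sq_nonneg η]

lemma secondDiff_fourierSuperposition (hi : Integrable h) (x η : ℝ) :
    secondDiff (fourierSuperposition h) x η =
      ∫ w, -(2 * (1 - Real.cos (2 * Real.pi * w * η))) *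
        (Complex.exp ((2 * Real.pi * w * x : ℝ) * Complex.I) * h w).re := by
  have hI := integrable_fourierSuperposition hi
  have hadd : Integrable fun w =>
      (Complex.exp ((2 * Real.pi * w * (x + η) : ℝ) * Complex.I) * h w).re +
      (Complex.exp ((2 * Real.pi * w * (x - η) : ℝ) * Complex.I) * h w).re :=
    (hI (x + η)).add (hI (x - η))
  unfold secondDiff fourierSuperposition
  rw [← integral_add (hI _) (hI _), ← integral_const_mul,
    ← integral_sub hadd ((hI _).const_mul _)]
  congr 1
  ext w
  simp only [Complex.mul_re, Complex.exp_ofReal_mul_I_re, Complex.exp_ofReal_mul_I_im, mul_add,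
    mul_sub, Real.cos_add, Real.cos_sub, Real.sin_add, Real.sin_sub]
  ring

/-- A plane wave is multiplied by `-2(1 - cos(2πwη))` under the second difference, and integration
in `η` gives the symbol. The second moment of `h` justifies Fubini. -/
lemma fracLap_fourierSuperposition (hs : 0 < s) (hs' : s < 1) (hi : Integrable h)
    (hi2 : Integrable fun w => w ^ 2 * ‖h w‖) (x : ℝ) :
    fracLap s (fourierSuperposition h) x =
      fourierSuperposition (fun w => ((-|2 * Real.pi * w| ^ (2 * s) : ℝ) : ℂ) * h w) x := by
  have hprod : Integrable (Function.uncurry fun (η w : ℝ) =>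
      -(2 * (1 - Real.cos (2 * Real.pi * w * η))) *
        (Complex.exp ((2 * Real.pi * w * x : ℝ) * Complex.I) * h w).re / η ^ (1 + 2 * s))
      ((volume.restrict (Ioi 0)).prod volume) := by
    have hd : Integrable fun w => (4 + (2 * Real.pi * w) ^ 2) * ‖h w‖ := by
      refine ((hi.norm.const_mul 4).add (hi2.const_mul ((2 * Real.pi) ^ 2))).congr
        (ae_of_all _ fun w => ?_)
      simp only [Pi.add_apply]
      ring
    have hmeas := (integrable_fourierSuperposition hi x).aestronglyMeasurable
    refine ((integrableOn_levyWeight hs hs').mul_prod hd).mono' ?_ ?_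
    · have h1 : AEStronglyMeasurable (fun z : ℝ × ℝ =>
          -(2 * (1 - Real.cos (2 * Real.pi * z.2 * z.1))) / z.1 ^ (1 + 2 * s))
          ((volume.restrict (Ioi 0)).prod volume) :=
        Measurable.aestronglyMeasurable (by fun_prop)
      refine (h1.mul hmeas.comp_snd).congr (ae_of_all _ fun z => ?_)
      simp only [Function.uncurry, Pi.mul_apply]
      ring
    · have hae : ∀ᵐ z : ℝ × ℝ ∂((volume.restrict (Ioi 0)).prod volume), 0 < z.1 :=
        Measure.quasiMeasurePreserving_fst.ae (ae_restrict_mem measurableSet_Ioi)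
      filter_upwards [hae] with z hz
      simp only [Function.uncurry]
      rw [norm_div, norm_mul, norm_neg, Real.norm_of_nonneg (Real.rpow_nonneg hz.le _),
        Real.norm_of_nonneg (by linarith [Real.cos_le_one (2 * Real.pi * z.2 * z.1)]), levyWeight,
        div_mul_eq_mul_div]
      refine div_le_div_of_nonneg_right ?_ (Real.rpow_nonneg hz.le _)
      exact (mul_le_mul (one_sub_cos_le _ _) (abs_re_cexp_mul_le _ _) (abs_nonneg _)
        (by positivity)).trans_eq (by ring)
  unfold fracLap
  simp only [secondDiff_fourierSuperposition hi, ← integral_div]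
  rw [integral_integral_swap hprod, ← integral_const_mul]
  unfold fourierSuperposition
  congr 1
  ext w
  have h1 : ∀ η : ℝ, -(2 * (1 - Real.cos (2 * Real.pi * w * η))) *
      (Complex.exp ((2 * Real.pi * w * x : ℝ) * Complex.I) * h w).re / η ^ (1 + 2 * s) =
      -2 * (Complex.exp ((2 * Real.pi * w * x : ℝ) * Complex.I) * h w).re *
      ((1 - Real.cos (2 * Real.pi * w * η)) / η ^ (1 + 2 * s)) := fun η => by ring
  simp only [h1]
  rw [integral_const_mul, integral_one_sub_cos_mul_div hs, mul_left_comm (Complex.exp _),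
    Complex.re_ofReal_mul]
  linear_combination (-|2 * Real.pi * w| ^ (2 * s) *
    (Complex.exp ((2 * Real.pi * w * x : ℝ) * Complex.I) * h w).re) *
    two_mul_fracConst_mul_cosLevyIntegral hs hs'

lemma integrable_rpow_mul (hs : 0 < s) (hs' : s < 1) (hi : Integrable h)
    (hi2 : Integrable fun w => w ^ 2 * ‖h w‖) :
    Integrable fun w => ((-|2 * Real.pi * w| ^ (2 * s) : ℝ) : ℂ) * h w := by
  have hd : Integrable fun w => (1 + (2 * Real.pi * w) ^ 2) * ‖h w‖ := by
    refine (hi.norm.add (hi2.const_mul ((2 * Real.pi) ^ 2))).congr (ae_of_all _ fun w => ?_)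
    simp only [Pi.add_apply]
    ring
  refine hd.mono' ?_ (ae_of_all _ fun w => ?_)
  · exact (Complex.measurable_ofReal.comp (by fun_prop)).aestronglyMeasurable.mul
      hi.aestronglyMeasurable
  · rw [norm_mul, Complex.norm_real, norm_neg, Real.norm_of_nonneg (by positivity)]
    gcongr
    rcases le_total |2 * Real.pi * w| 1 with h1 | h1
    · have := Real.rpow_le_one (abs_nonneg _) h1 (by linarith : 0 ≤ 2 * s)
      nlinarith [sq_nonneg (2 * Real.pi * w)]
    · have := Real.rpow_le_rpow_of_exponent_le h1 (by push_cast; linarith : 2 * s ≤ (2 : ℕ))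
      rw [Real.rpow_natCast, sq_abs] at this
      linarith

/-- Frequency by frequency this is the fundamental theorem of calculus for `exp(-τ|2πw|^(2s))`. The
integrated form is preferred because it survives pointwise bounded limits of the data. -/
lemma stableSemigroup_eq_add_integral_of_fourier (hs : 1 / 2 < s) (hs' : s < 1)
    (hi : Integrable h) (hi2 : Integrable fun w => w ^ 2 * ‖h w‖) (x : ℝ) {t : ℝ} (ht : 0 ≤ t) :
    stableSemigroup s (fourierSuperposition h) x t = fourierSuperposition h x +
      ∫ τ in (0 : ℝ)..t, stableSemigroup s (fracLap s (fourierSuperposition h)) x τ := by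
  have hs0 : 0 < s := by linarith
  have hiL := integrable_rpow_mul hs0 hs' hi hi2
  have hL : fracLap s (fourierSuperposition h) = _ :=
    funext (fracLap_fourierSuperposition hs0 hs' hi hi2)
  have hW := integrable_fourierSuperposition hiL x
  have hprod : Integrable (Function.uncurry fun (τ w : ℝ) =>
      Real.exp (-(τ * |2 * Real.pi * w| ^ (2 * s))) *
        (Complex.exp ((2 * Real.pi * w * x : ℝ) * Complex.I) *
          (((-|2 * Real.pi * w| ^ (2 * s) : ℝ) : ℂ) * h w)).re)
      ((volume.restrict (Ioc 0 t)).prod volume) := by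
    refine ((integrable_const (1 : ℝ)).mul_prod hW).norm.mono' ?_ ?_
    · have h1 : AEStronglyMeasurable (fun z : ℝ × ℝ =>
          Real.exp (-(z.1 * |2 * Real.pi * z.2| ^ (2 * s))))
          ((volume.restrict (Ioc 0 t)).prod volume) :=
        Measurable.aestronglyMeasurable (by fun_prop)
      exact h1.mul hW.aestronglyMeasurable.comp_snd
    · have hae : ∀ᵐ z : ℝ × ℝ ∂((volume.restrict (Ioc 0 t)).prod volume), z.1 ∈ Ioc 0 t :=
        Measure.quasiMeasurePreserving_fst.ae (ae_restrict_mem measurableSet_Ioc)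
      filter_upwards [hae] with z hz
      simp only [Function.uncurry]
      rw [norm_mul, norm_mul]
      gcongr
      rw [Real.norm_of_nonneg (Real.exp_pos _).le, norm_one, Real.exp_le_one_iff]
      have : 0 ≤ z.1 * |2 * Real.pi * z.2| ^ (2 * s) := mul_nonneg hz.1.le (by positivity)
      linarith
  have hE : ∫ τ in (0 : ℝ)..t, stableSemigroup s (fracLap s (fourierSuperposition h)) x τ =
      ∫ w, (Real.exp (-(t * |2 * Real.pi * w| ^ (2 * s))) *
        (Complex.exp ((2 * Real.pi * w * x : ℝ) * Complex.I) * h w).re -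
        (Complex.exp ((2 * Real.pi * w * x : ℝ) * Complex.I) * h w).re) := by
    rw [intervalIntegral.integral_of_le ht, hL,
      setIntegral_congr_fun measurableSet_Ioc
        (fun τ hτ => stableSemigroup_fourierSuperposition hs hs' hiL x hτ.1.le),
      integral_integral_swap hprod]
    congr 1
    ext w
    rw [integral_mul_const, mul_left_comm (Complex.exp _), Complex.re_ofReal_mul,
      ← intervalIntegral.integral_of_le ht, ← mul_assoc, ← intervalIntegral.integral_mul_const]
    have hd : ∀ τ ∈ uIcc 0 t, HasDerivAt (fun τ => Real.exp (-(τ * |2 * Real.pi * w| ^ (2 * s))))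
        (Real.exp (-(τ * |2 * Real.pi * w| ^ (2 * s))) * (-|2 * Real.pi * w| ^ (2 * s))) τ := by
      intro τ _
      exact (((hasDerivAt_id τ).mul_const _).neg.exp).congr_deriv (by simp)
    rw [intervalIntegral.integral_eq_sub_of_hasDerivAt hd
      (Continuous.intervalIntegrable (by fun_prop) _ _)]
    simp
    ring
  have hexp : Integrable fun w => Real.exp (-(t * |2 * Real.pi * w| ^ (2 * s))) *
      (Complex.exp ((2 * Real.pi * w * x : ℝ) * Complex.I) * h w).re := by
    refine (integrable_fourierSuperposition hi x).bdd_mul (c := 1)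
      (Measurable.aestronglyMeasurable (by fun_prop)) (ae_of_all _ fun w => ?_)
    rw [Real.norm_of_nonneg (Real.exp_pos _).le, Real.exp_le_one_iff]
    have : 0 ≤ t * |2 * Real.pi * w| ^ (2 * s) := by positivity
    linarith
  rw [hE, integral_sub hexp (integrable_fourierSuperposition hi x),
    stableSemigroup_fourierSuperposition hs hs' hi x ht, fourierSuperposition]
  ring

end Fourier

/-! ### Approximation by compactly supported functions. -/

lemma isBddSmooth_of_hasCompactSupport {f : ℝ → ℝ} (hf : ContDiff ℝ ∞ f)
    (hc : HasCompactSupport f) : IsBddSmooth f := by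
  refine ⟨hf, fun m => ?_⟩
  obtain ⟨C, -, hC⟩ := (hc.toSchwartzMap hf).decay 0 m
  refine ⟨C, fun x => ?_⟩
  have := hC x
  rw [pow_zero, one_mul, norm_iteratedFDeriv_eq_norm_iteratedDeriv] at this
  exact this

/-- Such `f` is a Schwartz function, so its Fourier transform is one too and has all moments;
inversion recovers `f`. -/
lemma exists_fourierSuperposition_of_hasCompactSupport {f : ℝ → ℝ} (hf : ContDiff ℝ ∞ f)
    (hc : HasCompactSupport f) : ∃ h : ℝ → ℂ, Integrable h ∧
      Integrable (fun w => w ^ 2 * ‖h w‖) ∧ f = fourierSuperposition h := by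
  have hf' : ContDiff ℝ ∞ fun x => (f x : ℂ) := Complex.ofRealCLM.contDiff.comp hf
  have hc' : HasCompactSupport fun x => (f x : ℂ) := hc.comp_left (g := Complex.ofReal) (by simp)
  set φ : SchwartzMap ℝ ℂ := hc'.toSchwartzMap hf'
  set ψ : SchwartzMap ℝ ℂ := 𝓕 φ
  have hψ : 𝓕 (φ : ℝ → ℂ) = ψ := (SchwartzMap.fourier_coe φ).symm
  refine ⟨ψ, ψ.integrable, ?_, ?_⟩
  · simpa using ψ.integrable_pow_mul volume 2
  · ext x
    have hF : Integrable (𝓕 (φ : ℝ → ℂ)) := hψ ▸ ψ.integrable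
    have h := congrFun (φ.continuous.fourierInv_fourier_eq φ.integrable hF) x
    rw [hψ, Real.fourierInv_eq'] at h
    have hx : φ x = (f x : ℂ) := rfl
    have hint : Integrable fun w : ℝ =>
        Complex.exp (↑(2 * Real.pi * inner ℝ w x) * Complex.I) • ψ w := by
      refine ψ.integrable.bdd_mul (c := 1) (by fun_prop) (ae_of_all _ fun w => ?_)
      rw [Complex.norm_exp_ofReal_mul_I]
    have h2 := congrArg Complex.re h
    rw [hx, Complex.ofReal_re, ← RCLike.re_eq_complex_re, ← integral_re hint] at h2
    rw [← h2, fourierSuperposition]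
    congr 1
    ext w
    rw [RCLike.re_eq_complex_re, smul_eq_mul, RCLike.inner_apply, conj_trivial, mul_comm x w,
      mul_assoc _ w x]

/-- A fixed smooth cutoff function. -/
def cutoffBump : ContDiffBump (0 : ℝ) := ⟨1, 2, one_pos, one_lt_two⟩

/-- The truncation of `f` to the scale `n + 1`. -/
def truncation (f : ℝ → ℝ) (n : ℕ) (x : ℝ) : ℝ := f x * cutoffBump (((n : ℝ) + 1)⁻¹ * x)

lemma isBddSmooth_cutoffBump : IsBddSmooth cutoffBump :=
  isBddSmooth_of_hasCompactSupport cutoffBump.contDiff cutoffBump.hasCompactSupport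

lemma abs_cutoffBump_le_one (x : ℝ) : |cutoffBump x| ≤ 1 := by
  rw [abs_of_nonneg cutoffBump.nonneg]
  exact cutoffBump.le_one

lemma inv_natCast_add_one_mem (n : ℕ) : 0 ≤ ((n : ℝ) + 1)⁻¹ ∧ ((n : ℝ) + 1)⁻¹ ≤ 1 :=
  ⟨by positivity, inv_le_one_of_one_le₀ (by linarith [(Nat.cast_nonneg n : (0 : ℝ) ≤ n)])⟩

section Truncation

variable {f : ℝ → ℝ}

lemma contDiff_truncation (hf : IsBddSmooth f) (n : ℕ) : ContDiff ℝ ∞ (truncation f n) :=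
  hf.1.mul (cutoffBump.contDiff.comp (contDiff_const.mul contDiff_id))

lemma hasCompactSupport_truncation (f : ℝ → ℝ) (n : ℕ) : HasCompactSupport (truncation f n) := by
  refine HasCompactSupport.mul_left ?_
  exact cutoffBump.hasCompactSupport.comp_homeomorph
    (Homeomorph.mulLeft₀ ((n : ℝ) + 1)⁻¹ (by positivity))

lemma abs_truncation_le {C : ℝ} (hC : ∀ x, |f x| ≤ C) (n : ℕ) (x : ℝ) :
    |truncation f n x| ≤ C := by
  rw [truncation, abs_mul]
  exact (mul_le_of_le_one_right (abs_nonneg _) (abs_cutoffBump_le_one _)).trans (hC x)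

lemma tendsto_truncation (f : ℝ → ℝ) (x : ℝ) :
    Tendsto (fun n => truncation f n x) atTop (𝓝 (f x)) := by
  refine tendsto_const_nhds.congr' ?_
  filter_upwards [eventually_ge_atTop ⌈|x|⌉₊] with n hn
  have hn' : |x| ≤ n := (Nat.le_ceil _).trans (by exact_mod_cast hn)
  rw [truncation, cutoffBump.one_of_mem_closedBall, mul_one]
  rw [mem_closedBall_zero_iff, norm_mul, Real.norm_of_nonneg (inv_natCast_add_one_mem n).1,
    inv_mul_le_iff₀ (by positivity)]
  change |x| ≤ (n + 1) * 1
  linarith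

lemma secondDiff_mul (f g : ℝ → ℝ) (x η : ℝ) :
    secondDiff (fun x => f x * g x) x η = g x * secondDiff f x η + f x * secondDiff g x η +
      (f (x + η) - f x) * (g (x + η) - g x) + (f (x - η) - f x) * (g (x - η) - g x) := by
  unfold secondDiff
  ring

/-- Uniformity in `n` is the point: it dominates `fracLap` of all truncations at once. The dilation
factor of the cutoff is at most one, so it only decreases the Lipschitz and second-difference
constants entering the product rule. -/
lemma exists_secondDiffBound_truncation (hf : IsBddSmooth f) :
    ∃ M, ∀ n, SecondDiffBound M (truncation f n) := by
  obtain ⟨A, hA, h0⟩ := hf.exists_bound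
  obtain ⟨L, hL, h1⟩ := hf.exists_lipschitz
  obtain ⟨B, hB, h2⟩ := hf.exists_secondDiff_le_sq
  obtain ⟨L', hL', h1'⟩ := isBddSmooth_cutoffBump.exists_lipschitz
  obtain ⟨B', hB', h2'⟩ := isBddSmooth_cutoffBump.exists_secondDiff_le_sq
  refine ⟨4 * A + (B + A * B' + 2 * (L * L')), fun n => ?_⟩
  refine secondDiffBound_of_le hA (by positivity) (abs_truncation_le h0 n) fun x η => ?_
  obtain ⟨hc0, hc1⟩ := inv_natCast_add_one_mem n
  set c := ((n : ℝ) + 1)⁻¹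
  have e1 : ∀ y z, |cutoffBump (c * y) - cutoffBump (c * z)| ≤ L' * |y - z| := by
    intro y z
    refine (h1' _ _).trans ?_
    rw [← mul_sub, abs_mul, abs_of_nonneg hc0]
    gcongr
    exact mul_le_of_le_one_left (abs_nonneg _) hc1
  have e2 : |secondDiff (fun x => cutoffBump (c * x)) x η| ≤ B' * η ^ 2 := by
    have h := h2' (c * x) (c * η)
    simp only [secondDiff, ← mul_add, ← mul_sub] at h ⊢
    refine h.trans ?_
    rw [mul_pow]
    gcongr
    exact mul_le_of_le_one_left (sq_nonneg _) (pow_le_one₀ hc0 hc1)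
  have e3 : ∀ y, |y - x| = |η| →
      |(f y - f x) * (cutoffBump (c * y) - cutoffBump (c * x))| ≤ L * L' * η ^ 2 := by
    intro y hy
    rw [abs_mul]
    calc _ ≤ (L * |y - x|) * (L' * |y - x|) := by
          gcongr
          · exact h1 _ _
          · exact e1 _ _
      _ = L * L' * (|η| * |η|) := by rw [hy]; ring
      _ = _ := by rw [abs_mul_abs_self]; ring
  have e4 : |cutoffBump (c * x) * secondDiff f x η| ≤ B * η ^ 2 := by
    rw [abs_mul]
    exact (mul_le_of_le_one_left (abs_nonneg _) (abs_cutoffBump_le_one _)).trans (h2 x η)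
  have e5 : |f x * secondDiff (fun x => cutoffBump (c * x)) x η| ≤ A * (B' * η ^ 2) := by
    rw [abs_mul]
    exact mul_le_mul (h0 x) e2 (abs_nonneg _) hA
  have e6 := e3 (x + η) (by simp)
  have e7 := e3 (x - η) (by simp)
  have hs : secondDiff (truncation f n) x η = _ :=
    secondDiff_mul f (fun x => cutoffBump (c * x)) x η
  rw [hs]
  refine (abs_add_le _ _).trans ((add_le_add ((abs_add_le _ _).trans
    (add_le_add ((abs_add_le _ _).trans (add_le_add e4 e5)) e6)) e7).trans_eq ?_)
  ring

end Truncation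

lemma tendsto_fracLap {s : ℝ} (hs : 0 < s) (hs' : s < 1) {F : ℕ → ℝ → ℝ} {f : ℝ → ℝ} {M : ℝ}
    (hF : ∀ n, Continuous (F n)) (hM : ∀ n, SecondDiffBound M (F n))
    (hl : ∀ x, Tendsto (fun n => F n x) atTop (𝓝 (f x))) (x : ℝ) :
    Tendsto (fun n => fracLap s (F n) x) atTop (𝓝 (fracLap s f x)) := by
  refine Tendsto.const_mul _ (tendsto_integral_of_dominated_convergence
    (fun η => M * levyWeight s η)
    (fun n => (continuousOn_secondDiff_div (hF n) s x).aestronglyMeasurable measurableSet_Ioi)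
    ((integrableOn_levyWeight hs hs').const_mul M) (fun n => ?_) (ae_of_all _ fun η => ?_))
  · exact (ae_restrict_iff' measurableSet_Ioi).2
      (ae_of_all _ fun η hη => (hM n).norm_div_le s x hη)
  · exact (((hl _).add (hl _)).sub ((hl _).const_mul 2)).div_const _

/-! ### The evolution equation on bounded smooth data. -/

namespace IsBddSmooth

variable {s : ℝ} {f : ℝ → ℝ}

lemma continuous_stableSemigroup (hf : IsBddSmooth f) (hs : 1 / 2 < s) (hs' : s < 1) :
    Continuous fun p : ℝ × ℝ => stableSemigroup s f p.1 p.2 := by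
  obtain ⟨C, -, hC⟩ := hf.exists_bound
  exact _root_.continuous_stableSemigroup hs hs' hf.continuous hC

/-- The identity holds for each truncation by Fourier analysis, and every term passes to the limit
by dominated convergence, the values of `fracLap` being bounded uniformly in `n`. -/
lemma stableSemigroup_eq_add_integral (hf : IsBddSmooth f) (hs : 1 / 2 < s) (hs' : s < 1) (x : ℝ)
    {t : ℝ} (ht : 0 ≤ t) : stableSemigroup s f x t =
      f x + ∫ τ in (0 : ℝ)..t, stableSemigroup s (_root_.fracLap s f) x τ := by
  have hs0 : 0 < s := by linarith
  obtain ⟨C, -, hC⟩ := hf.exists_bound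
  obtain ⟨M, hM⟩ := exists_secondDiffBound_truncation hf
  have hsm : ∀ n, IsBddSmooth (truncation f n) := fun n =>
    isBddSmooth_of_hasCompactSupport (contDiff_truncation hf n) (hasCompactSupport_truncation f n)
  have hid : ∀ n, stableSemigroup s (truncation f n) x t = truncation f n x +
      ∫ τ in (0 : ℝ)..t, stableSemigroup s (_root_.fracLap s (truncation f n)) x τ := by
    intro n
    obtain ⟨h, hi, hi2, he⟩ := exists_fourierSuperposition_of_hasCompactSupport
      (contDiff_truncation hf n) (hasCompactSupport_truncation f n)
    rw [he]
    exact stableSemigroup_eq_add_integral_of_fourier hs hs' hi hi2 x ht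
  have hL := fun n y => (hM n).abs_fracLap_le hs0 hs' y
  refine tendsto_nhds_unique (tendsto_stableSemigroup hs hs' (fun n => (hsm n).continuous)
    (abs_truncation_le hC) (tendsto_truncation f) x t) ?_
  simp only [hid]
  refine (tendsto_truncation f x).add ?_
  refine intervalIntegral.tendsto_integral_filter_of_dominated_convergence
    (fun _ => |fracConst s| * (M * ∫ η in Ioi (0 : ℝ), levyWeight s η)) ?_ ?_ ?_ ?_
  · refine Eventually.of_forall fun n => Continuous.aestronglyMeasurable ?_
    exact (((hsm n).fracLap hs0 hs').continuous_stableSemigroup hs hs').comp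
      (continuous_const.prodMk continuous_id)
  · exact Eventually.of_forall fun n => ae_of_all _ fun τ _ =>
      abs_stableSemigroup_le hs hs' (hL n) x τ
  · exact intervalIntegrable_const
  · refine ae_of_all _ fun τ _ => ?_
    exact tendsto_stableSemigroup hs hs' (fun n => ((hsm n).fracLap hs0 hs').continuous) hL
      (tendsto_fracLap hs0 hs' (fun n => (hsm n).continuous) hM (tendsto_truncation f)) x τ

lemma hasDerivWithinAt_stableSemigroup (hf : IsBddSmooth f) (hs : 1 / 2 < s) (hs' : s < 1) (x : ℝ)
    {t : ℝ} (ht : 0 ≤ t) : HasDerivWithinAt (fun t => stableSemigroup s f x t)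
      (stableSemigroup s (_root_.fracLap s f) x t) (Ici 0) t := by
  have hc : Continuous fun τ => stableSemigroup s (_root_.fracLap s f) x τ :=
    ((hf.fracLap (by linarith) hs').continuous_stableSemigroup hs hs').comp
      (continuous_const.prodMk continuous_id)
  -- The integral expression is differentiable on both sides of `t`; it agrees with the semigroup
  -- only for nonnegative times, hence the one-sided conclusion.
  have h : HasDerivAt (fun t => f x + ∫ τ in (0 : ℝ)..t,
      stableSemigroup s (_root_.fracLap s f) x τ) (stableSemigroup s (_root_.fracLap s f) x t) t :=
    (hc.integral_hasStrictDerivAt 0 t).hasDerivAt.const_add _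
  exact h.hasDerivWithinAt.congr (fun τ hτ => hf.stableSemigroup_eq_add_integral hs hs' x hτ)
    (hf.stableSemigroup_eq_add_integral hs hs' x ht)

/-- The semigroup averages translates and `fracLap` is translation invariant, so the two commute by
Fubini. -/
lemma stableSemigroup_fracLap (hf : IsBddSmooth f) (hs : 1 / 2 < s) (hs' : s < 1) (x t : ℝ) :
    stableSemigroup s (_root_.fracLap s f) x t =
      _root_.fracLap s (fun x => stableSemigroup s f x t) x := by
  have hs0 : 0 < s := by linarith
  obtain ⟨C, -, hC⟩ := hf.exists_bound
  obtain ⟨M, -, hM⟩ := hf.exists_secondDiffBound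
  have hcont := hf.continuous
  have hi := fun x => integrable_stableSemigroup hs hs' hf.continuous hC x t
  have hsd : ∀ η, secondDiff (fun x => stableSemigroup s f x t) x η =
      ∫ y, stableDensity s y * secondDiff f (x - timeScale s t * y) η := by
    intro η
    have hadd : Integrable fun y => stableDensity s y * f (x + η - timeScale s t * y) +
        stableDensity s y * f (x - η - timeScale s t * y) := (hi _).add (hi _)
    unfold secondDiff stableSemigroup
    rw [← integral_add (hi _) (hi _), ← integral_const_mul,
      ← integral_sub hadd ((hi _).const_mul _)]
    congr 1
    ext y
    rw [show x + η - timeScale s t * y = x - timeScale s t * y + η by ring,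
      show x - η - timeScale s t * y = x - timeScale s t * y - η by ring]
    ring
  have hprod : Integrable (Function.uncurry fun (y η : ℝ) => stableDensity s y *
      (secondDiff f (x - timeScale s t * y) η / η ^ (1 + 2 * s)))
      (volume.prod (volume.restrict (Ioi 0))) := by
    refine ((integrable_stableDensity hs hs').mul_prod
      ((integrableOn_levyWeight hs0 hs').const_mul M)).mono' ?_ ?_
    · apply Measurable.aestronglyMeasurable
      have := (continuous_stableDensity hs).measurable
      have := hcont.measurable
      unfold Function.uncurry secondDiff
      fun_prop
    · have hae : ∀ᵐ z : ℝ × ℝ ∂(volume.prod (volume.restrict (Ioi 0))), 0 < z.2 :=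
        Measure.quasiMeasurePreserving_snd.ae (ae_restrict_mem measurableSet_Ioi)
      filter_upwards [hae] with z hz
      exact norm_stableDensity_mul_le hs hs' z.1 (hM.norm_div_le s _ hz)
  have hswap := integral_integral_swap hprod
  unfold _root_.fracLap
  simp only [hsd, ← integral_div, mul_div_assoc]
  rw [← hswap, stableSemigroup, ← integral_const_mul]
  congr 1
  ext y
  rw [integral_const_mul]
  ring

end IsBddSmooth

/-! ### Calculus of the classes `C_b^k` on sets of unique differentiability. -/

section IsCb

variable {E F G : Type*} [NormedAddCommGroup E] [NormedSpace ℝ E] [NormedAddCommGroup F]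
  [NormedSpace ℝ F] [NormedAddCommGroup G] [NormedSpace ℝ G] {S : Set E}

lemma IsCb.mono {k l : ℕ∞} {f : E → F} (h : IsCb l f S) (hkl : k ≤ l) : IsCb k f S :=
  ⟨h.1.of_le (by exact_mod_cast hkl), fun m hm => h.2 m (hm.trans hkl)⟩

lemma isCb_top_of_forall_nat {f : E → F} (h : ∀ k : ℕ, IsCb k f S) : IsCb ⊤ f S :=
  ⟨contDiffOn_infty.2 fun k => (h k).1, fun m _ => (h m).2 m le_rfl⟩

lemma IsCb.add {k : ℕ∞} {f g : E → F} (hS : UniqueDiffOn ℝ S) (hf : IsCb k f S)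
    (hg : IsCb k g S) : IsCb k (fun p => f p + g p) S := by
  refine ⟨hf.1.add hg.1, fun m hm => ?_⟩
  obtain ⟨C, hC⟩ := hf.2 m hm
  obtain ⟨D, hD⟩ := hg.2 m hm
  have hm' : (m : WithTop ℕ∞) ≤ (k : WithTop ℕ∞) := by exact_mod_cast hm
  refine ⟨C + D, fun p hp => ?_⟩
  have h := iteratedFDerivWithin_add_apply (((hf.1 p hp).of_le hm')) (((hg.1 p hp).of_le hm')) hS hp
  have h' : iteratedFDerivWithin ℝ m (fun p => f p + g p) S p = _ := h
  rw [h']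
  exact (norm_add_le _ _).trans (add_le_add (hC p hp) (hD p hp))

lemma IsCb.continuousLinearMap_comp {k : ℕ∞} {f : E → F} (hS : UniqueDiffOn ℝ S)
    (hf : IsCb k f S) (L : F →L[ℝ] G) : IsCb k (fun p => L (f p)) S := by
  refine ⟨L.contDiff.comp_contDiffOn hf.1, fun m hm => ?_⟩
  obtain ⟨C, hC⟩ := hf.2 m hm
  have hm' : (m : WithTop ℕ∞) ≤ (k : WithTop ℕ∞) := by exact_mod_cast hm
  refine ⟨‖L‖ * C, fun p hp => ?_⟩
  have h : iteratedFDerivWithin ℝ m (fun p => L (f p)) S p = _ :=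
    L.iteratedFDerivWithin_comp_left (hf.1 p hp) hS hp hm'
  rw [h]
  exact (ContinuousLinearMap.norm_compContinuousMultilinearMap_le L _).trans
    (by gcongr; exact hC p hp)

lemma isCb_zero {f : E → F} {C : ℝ} (hf : ContinuousOn f S) (hC : ∀ p ∈ S, ‖f p‖ ≤ C) :
    IsCb (0 : ℕ) f S := by
  refine ⟨contDiffOn_zero.2 hf, fun m hm => ?_⟩
  obtain rfl : m = 0 := by simpa using hm
  exact ⟨C, fun p hp => by simpa using hC p hp⟩

/-- The inductive step for regularity: derivatives of `f` of positive order have the norms of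
derivatives of `f'` of one order less. -/
lemma IsCb.succ {k : ℕ} {f : E → F} {f' : E → E →L[ℝ] F} {C : ℝ} (hS : UniqueDiffOn ℝ S)
    (hC : ∀ p ∈ S, ‖f p‖ ≤ C) (hf : ∀ p ∈ S, HasFDerivWithinAt f (f' p) S p)
    (hf' : IsCb k f' S) : IsCb (k + 1 : ℕ) f S := by
  have heq : EqOn (fderivWithin ℝ f S) f' S := fun p hp => (hf p hp).fderivWithin (hS p hp)
  constructor
  · have h := (contDiffOn_succ_iff_fderivWithin (n := (k : WithTop ℕ∞)) hS).2
      ⟨fun p hp => (hf p hp).differentiableWithinAt, by simp, ?_⟩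
    · exact_mod_cast h
    · exact (hf'.1.congr heq)
  · intro m hm
    cases m with
    | zero => exact ⟨C, fun p hp => by simpa using hC p hp⟩
    | succ m =>
      obtain ⟨D, hD⟩ := hf'.2 m (by
        have : m + 1 ≤ k + 1 := by exact_mod_cast hm
        exact_mod_cast Nat.le_of_succ_le_succ this)
      refine ⟨D, fun p hp => ?_⟩
      rw [← norm_iteratedFDerivWithin_fderivWithin hS hp, iteratedFDerivWithin_congr heq hp]
      exact hD p hp

end IsCb

/-! ### Joint regularity of the semigroup in space and time. -/

namespace IsBddSmooth

variable {s : ℝ} {f : ℝ → ℝ}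

/-- The increment is split into a spatial move at the new time `q.2` and a temporal move at the old
point `p.1`. Joint continuity of `S f'` makes the spatial part uniform in `q.2`; the temporal part
is the one-sided derivative, which covers `t = 0`. -/
lemma hasFDerivWithinAt_stableSemigroup (hf : IsBddSmooth f) (hs : 1 / 2 < s) (hs' : s < 1)
    {p : ℝ × ℝ} (hp : 0 ≤ p.2) :
    HasFDerivWithinAt (fun p : ℝ × ℝ => stableSemigroup s f p.1 p.2)
      (stableSemigroup s (_root_.deriv f) p.1 p.2 • ContinuousLinearMap.fst ℝ ℝ ℝ +
        stableSemigroup s (_root_.fracLap s f) p.1 p.2 • ContinuousLinearMap.snd ℝ ℝ ℝ)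
      (univ ×ˢ Ici 0) p := by
  set l := 𝓝[univ ×ˢ Ici (0 : ℝ)] p
  have hl : l ≤ 𝓝 p := nhdsWithin_le_nhds
  have hv : Tendsto (fun q : ℝ × ℝ => q.1) l (𝓝 p.1) := (continuous_fst.tendsto p).mono_left hl
  have hv2 : Tendsto (fun q : ℝ × ℝ => q.2) l (𝓝[Ici 0] p.2) := by
    refine tendsto_nhdsWithin_iff.2 ⟨(continuous_snd.tendsto p).mono_left hl, ?_⟩
    filter_upwards [self_mem_nhdsWithin] with q hq using hq.2
  have h1 : (fun q : ℝ × ℝ => stableSemigroup s f q.1 q.2 - stableSemigroup s f p.1 q.2 -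
      stableSemigroup s (_root_.deriv f) p.1 p.2 * (q.1 - p.1)) =o[l] fun q => q.1 - p.1 := by
    refine Asymptotics.isLittleO_iff.2 fun c hc => ?_
    obtain ⟨δ, hδ, hball⟩ := Metric.continuous_iff.1
      (hf.deriv.continuous_stableSemigroup hs hs') p c hc
    filter_upwards [hl (Metric.ball_mem_nhds p hδ)] with q hq
    have hd : ∀ z, HasDerivAt (fun z => stableSemigroup s f z q.2 -
        stableSemigroup s (_root_.deriv f) p.1 p.2 * z) (stableSemigroup s (_root_.deriv f) z q.2 -
        stableSemigroup s (_root_.deriv f) p.1 p.2) z := fun z =>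
      ((hf.hasDerivAt_stableSemigroup hs hs' z q.2).sub
        ((hasDerivAt_id z).const_mul _)).congr_deriv (by simp)
    have key := Convex.norm_image_sub_le_of_norm_hasDerivWithin_le (C := c)
      (fun z _ => (hd z).hasDerivWithinAt) (fun z hz => ?_) (convex_uIcc p.1 q.1)
      left_mem_uIcc right_mem_uIcc
    · refine le_of_eq_of_le (congrArg _ ?_) key
      ring
    · refine (hball (z, q.2) ?_).le
      rw [Metric.mem_ball, Prod.dist_eq, max_lt_iff] at hq
      rw [Prod.dist_eq, max_lt_iff]
      exact ⟨(abs_sub_left_of_mem_uIcc hz).trans_lt hq.1, hq.2⟩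
  have h2 := (hasFDerivWithinAt_iff_isLittleO.1 (hf.hasDerivWithinAt_stableSemigroup hs hs' p.1
    hp).hasFDerivWithinAt).comp_tendsto hv2
  rw [hasFDerivWithinAt_iff_isLittleO]
  have h1' := h1.trans_isBigO (Asymptotics.isBigO_of_le l
    (g := fun q : ℝ × ℝ => q - p) fun q => norm_fst_le (q - p))
  have h2' := h2.trans_isBigO (Asymptotics.isBigO_of_le l
    (g := fun q : ℝ × ℝ => q - p) fun q => norm_snd_le (q - p))
  refine (h1'.add h2').congr_left fun q => ?_
  simp
  ring

variable {E : Type*} [NormedAddCommGroup E] [NormedSpace ℝ E]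

/-- The derivative is built linearly from `S f'` and `S L f`, whose data are again bounded smooth.
The induction on `k` therefore has to run over all data simultaneously. -/
lemma isCb_nat_stableSemigroup (hs : 1 / 2 < s) (hs' : s < 1) (L : E →L[ℝ] ℝ) (k : ℕ)
    (hf : IsBddSmooth f) :
    IsCb k (fun p : E × ℝ => stableSemigroup s f (L p.1) p.2) (univ ×ˢ Ici 0) := by
  have hS : UniqueDiffOn ℝ ((univ : Set E) ×ˢ Ici (0 : ℝ)) :=
    uniqueDiffOn_univ.prod (uniqueDiffOn_Ici 0)
  induction k generalizing f with
  | zero =>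
    obtain ⟨C, -, hC⟩ := hf.exists_bound
    refine isCb_zero (C := C) (Continuous.continuousOn ?_)
      fun p _ => abs_stableSemigroup_le hs hs' hC _ _
    exact (hf.continuous_stableSemigroup hs hs').comp
      ((L.continuous.comp continuous_fst).prodMk continuous_snd)
  | succ k ih =>
    obtain ⟨C, -, hC⟩ := hf.exists_bound
    set Λ : E × ℝ →L[ℝ] ℝ × ℝ := (L.comp (ContinuousLinearMap.fst ℝ E ℝ)).prod
      (ContinuousLinearMap.snd ℝ E ℝ)
    refine IsCb.succ (C := C) hS (fun p _ => abs_stableSemigroup_le hs hs' hC _ _)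
      (fun p hp => ((hf.hasFDerivWithinAt_stableSemigroup hs hs' (p := Λ p) hp.2).comp p
        Λ.hasFDerivWithinAt (fun q hq => ⟨mem_univ _, hq.2⟩))) ?_
    have h1 := (ih hf.deriv).continuousLinearMap_comp hS
      (ContinuousLinearMap.toSpanSingleton ℝ (L.comp (ContinuousLinearMap.fst ℝ E ℝ)))
    have h2 := (ih (hf.fracLap (by linarith) hs')).continuousLinearMap_comp hS
      (ContinuousLinearMap.toSpanSingleton ℝ (ContinuousLinearMap.snd ℝ E ℝ))
    convert! h1.add hS h2 using 1

lemma isCb_stableSemigroup (hf : IsBddSmooth f) (hs : 1 / 2 < s) (hs' : s < 1) (L : E →L[ℝ] ℝ) :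
    IsCb ⊤ (fun p : E × ℝ => stableSemigroup s f (L p.1) p.2) (univ ×ˢ Ici 0) :=
  isCb_top_of_forall_nat fun k => isCb_nat_stableSemigroup hs hs' L k hf

lemma exists_secondDiffBound_stableSemigroup {s : ℝ} {f : ℝ → ℝ} (hf : IsBddSmooth f)
    (hs : 1 / 2 < s) (hs' : s < 1) (t : ℝ) :
    ∃ M, SecondDiffBound M (fun x => stableSemigroup s f x t) := by
  have hd : ∀ {g : ℝ → ℝ}, IsBddSmooth g → _root_.deriv (fun x => stableSemigroup s g x t) =
      fun x => stableSemigroup s (_root_.deriv g) x t := fun hg =>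
    funext fun x => (hg.hasDerivAt_stableSemigroup hs hs' x t).deriv
  have hiter : ∀ m, _root_.iteratedDeriv m (fun x => stableSemigroup s f x t) =
      fun x => stableSemigroup s (_root_.iteratedDeriv m f) x t := by
    intro m
    induction m with
    | zero => simp
    | succ m ih => rw [iteratedDeriv_succ, ih, hd (hf.iteratedDeriv m), iteratedDeriv_succ]
  have hsm : IsBddSmooth (fun x => stableSemigroup s f x t) := by
    refine ⟨contDiff_of_differentiable_iteratedDeriv fun m _ x => ?_, fun m => ?_⟩
    · rw [hiter]
      exact ((hf.iteratedDeriv m).hasDerivAt_stableSemigroup hs hs' x t).differentiableAt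
    · obtain ⟨C, -, hC⟩ := (hf.iteratedDeriv m).exists_bound
      exact ⟨C, fun x => by rw [hiter]; exact abs_stableSemigroup_le hs hs' hC x t⟩
  obtain ⟨M, -, hM⟩ := hsm.exists_secondDiffBound
  exact ⟨M, hM⟩

end IsBddSmooth

/-! ### Reduction of the infinity fractional Laplacian for monotone profiles. -/

section InfinityLaplacian

/-- No integrability is needed: the positive part grows, the negative part shrinks, and subtraction
in `EReal` respects this even for infinite terms. That matters because the integrals for `y ≠ y'`
may diverge. -/
lemma extIntegral_mono {f g : ℝ → ℝ} (h : ∀ η, 0 < η → f η ≤ g η) :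
    extIntegral f ≤ extIntegral g := by
  refine EReal.sub_le_sub ?_ ?_
  · exact EReal.coe_ennreal_le_coe_ennreal_iff.2 (setLIntegral_mono' measurableSet_Ioi
      fun η hη => ENNReal.ofReal_le_ofReal (h η hη))
  · exact EReal.coe_ennreal_le_coe_ennreal_iff.2 (setLIntegral_mono' measurableSet_Ioi
      fun η hη => ENNReal.ofReal_le_ofReal (neg_le_neg (h η hη)))

lemma extIntegral_eq_integral {f : ℝ → ℝ} (hf : IntegrableOn f (Ioi 0)) :
    extIntegral f = ((∫ η in Ioi (0 : ℝ), f η : ℝ) : EReal) := by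
  have h1 : ∫⁻ η in Ioi (0 : ℝ), ENNReal.ofReal (f η) ≠ ⊤ := Integrable.lintegral_lt_top hf |>.ne
  have h2 : ∫⁻ η in Ioi (0 : ℝ), ENNReal.ofReal (-f η) ≠ ⊤ :=
    Integrable.lintegral_lt_top hf.neg |>.ne
  rw [integral_eq_lintegral_pos_part_sub_lintegral_neg_part hf, EReal.coe_sub,
    EReal.coe_ennreal_toReal h1, EReal.coe_ennreal_toReal h2]
  rfl

/-- For a nondecreasing one-dimensional profile the supremum and the infimum in the infinity
fractional Laplacian are both attained at the first basis vector. -/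
lemma infFracLaplacian_profile {n : ℕ} (i : Fin n) {s : ℝ} (hs : 0 < s) (hs' : s < 1)
    {φ : ℝ → ℝ} (hφ : Monotone φ) (hc : Continuous φ) {M : ℝ} (hM : SecondDiffBound M φ)
    (x : EuclideanSpace ℝ (Fin n)) :
    infFracLaplacian s (fun z => φ (z i)) x = ((fracLap s φ (x i) : ℝ) : EReal) := by
  set e : EuclideanSpace ℝ (Fin n) := EuclideanSpace.single i 1
  have he : e ∈ Metric.sphere (0 : EuclideanSpace ℝ (Fin n)) 1 := by simp [e]
  have hei : e i = 1 := by simp [e]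
  have hle : ∀ y ∈ Metric.sphere (0 : EuclideanSpace ℝ (Fin n)) 1, y i ≤ 1 := by
    intro y hy
    rw [mem_sphere_zero_iff_norm] at hy
    exact (le_abs_self _).trans ((PiLp.norm_apply_le y i).trans hy.le)
  have hV : extIntegral (fun η => secondDiff φ (x i) η / η ^ (1 + 2 * s)) =
      ((∫ η in Ioi (0 : ℝ), secondDiff φ (x i) η / η ^ (1 + 2 * s) : ℝ) : EReal) :=
    extIntegral_eq_integral (hM.integrableOn hc hs hs' (x i))
  rw [infFracLaplacian, fracLap, EReal.coe_mul, ← hV]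
  congr 1
  apply le_antisymm
  -- Upper bound: for each `y` the infimum is tested with `y' = e`, and then `y` is compared with
  -- `e`.
  · refine iSup₂_le fun y hy => (iInf₂_le e he).trans (extIntegral_mono fun η hη => ?_)
    refine div_le_div_of_nonneg_right ?_ (Real.rpow_nonneg hη.le _)
    have h1 : φ ((x + η • y) i) ≤ φ (x i + η) := by
      refine hφ ?_
      simpa using mul_le_of_le_one_right hη.le (hle y hy)
    have h2 : φ ((x - η • e) i) = φ (x i - η) := by simp [hei]
    rw [secondDiff, h2]
    linarith
  -- Lower bound: the supremum is tested with `y = e`, and each `y'` is compared with `e`.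
  · refine le_iSup₂_of_le e he (le_iInf₂ fun y hy => extIntegral_mono fun η hη => ?_)
    refine div_le_div_of_nonneg_right ?_ (Real.rpow_nonneg hη.le _)
    have h1 : φ (x i - η) ≤ φ ((x - η • y) i) := by
      refine hφ ?_
      have := mul_le_of_le_one_right hη.le (hle y hy)
      simp only [PiLp.sub_apply, PiLp.smul_apply, smul_eq_mul]
      linarith
    have h2 : φ ((x + η • e) i) = φ (x i + η) := by simp [hei]
    rw [secondDiff, h2]
    linarith

end InfinityLaplacian

end

/-! ### The main theorem. -/

theorem theorem2p10 (n : ℕ) (hn : 2 ≤ n) (s : ℝ) (hs : 1 / 2 < s) (hs' : s < 1)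
    (U₀ : ℝ → ℝ) (hU₀ : IsCb ⊤ U₀ (Set.univ : Set ℝ)) (hmono : Monotone U₀)
    (u₀ : EuclideanSpace ℝ (Fin n) → ℝ)
    (hu₀ : ∀ x : EuclideanSpace ℝ (Fin n), u₀ x = U₀ (x ⟨0, Nat.zero_lt_of_lt hn⟩)) :
    ∃ u : EuclideanSpace ℝ (Fin n) → ℝ → ℝ,
      IsCb ⊤ (fun p : EuclideanSpace ℝ (Fin n) × ℝ => u p.1 p.2)
        ((Set.univ : Set (EuclideanSpace ℝ (Fin n))) ×ˢ Set.Ici (0 : ℝ)) ∧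
      IsClassicalSolution s u₀ u ∧
      ∀ (x : EuclideanSpace ℝ (Fin n)) (t : ℝ), 0 < t →
        MeasureTheory.Integrable
          (fun r : ℝ => fracHeatKernel s (x ⟨0, Nat.zero_lt_of_lt hn⟩ - r) t * U₀ r) ∧
        u x t =
          ∫ r : ℝ, fracHeatKernel s (x ⟨0, Nat.zero_lt_of_lt hn⟩ - r) t * U₀ r := by
  set i : Fin n := ⟨0, Nat.zero_lt_of_lt hn⟩
  have hf := isBddSmooth_of_isCb hU₀
  obtain ⟨C, -, hC⟩ := hf.exists_bound
  have hreg : IsCb ⊤ (fun p : EuclideanSpace ℝ (Fin n) × ℝ => stableSemigroup s U₀ (p.1 i) p.2)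
      ((Set.univ : Set (EuclideanSpace ℝ (Fin n))) ×ˢ Set.Ici (0 : ℝ)) :=
    hf.isCb_stableSemigroup hs hs' (EuclideanSpace.proj i)
  refine ⟨fun x t => stableSemigroup s U₀ (x i) t, hreg, ⟨hreg.mono le_top, fun x t ht => ?_,
    fun x => ?_⟩, fun x t ht => ⟨integrable_fracHeatKernel_mul hs hs' hf.continuous hC _ ht,
    (integral_fracHeatKernel_mul hs U₀ _ ht).symm⟩⟩
  -- For `t > 0` the half-line is a neighbourhood of `t`, so the one-sided derivative is the full
  -- one.
  · have hd := (hf.hasDerivWithinAt_stableSemigroup hs hs' (x i) ht.le).hasDerivAt (Ici_mem_nhds ht)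
    obtain ⟨M, hM⟩ := hf.exists_secondDiffBound_stableSemigroup hs hs' t
    have hc : Continuous fun z => stableSemigroup s U₀ z t :=
      (hf.continuous_stableSemigroup hs hs').comp (continuous_id.prodMk continuous_const)
    rw [hd.deriv, hf.stableSemigroup_fracLap hs hs']
    exact (infFracLaplacian_profile i (by linarith) hs'
      (monotone_stableSemigroup hs hs' hf.continuous hC hmono t) hc hM x).symm
  · rw [hu₀, stableSemigroup_zero hs hs']
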